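/- Let $M$ be a connected non-orientable smooth Riemannian surface without boundary (for a surface with boundary, take its interior), let $\pi:\widetilde M\to M$ be its orientation double cover with the pulled-back metric, and let $\tau:\widetilde M\to\widetilde M$ be the orientation-reversing involution exchanging the two points of each fibre. A *twisted* function on $M$ is a function $f$ on $\widetilde M$ with $f\circ\tau=-f$; a *regular* one satisfies $f\circ\tau=f$, i.e. is a function on $M$. Let $\widetilde G$ be a (hydrodynamic) Green's function of the Laplacian on $\widetilde M$: $\widetilde G(x,y)=\widetilde G(y,x)$, $\widetilde G(\cdot,y)$ is smooth on $\widetilde M\setminus\{y\}$, $\widetilde G(\cdot,y)$ and its gradient are locally integrable, and $\Delta\widetilde G(\cdot,y)=\delta_y-\kappa$ in the sense of distributions, that is $-\int\langle\nabla\widetilde G(\cdot,y),\nabla\varphi\rangle\,dA=\varphi(y)-\kappa\int\varphi\,dA$ for all $\varphi\in C_c^\infty(\widetilde M)$, with $\kappa=1/\mathrm{Area}(\widetilde M)$ if $\widetilde M$ is closed and $\kappa=0$ otherwise. If $\widetilde M$ is not compact, assume that the hydrodynamic conditions at its ends are symmetric under $\tau$, in the following sense: * the circulation of $\widetilde G(\cdot,\tau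 y)$ around the end $\tau(e)$ equals that of $\widetilde G(\cdot,y)$ around the end $e$; precisely, with $C_y(\varphi)=\varphi(y)+\int\langle\nabla\widetilde G(\cdot,y),\nabla\varphi\rangle\,dA$, one has $C_{\tau y}(\varphi\circ\tau)=C_y(\varphi)$ for every smooth $\varphi$ such that $d\varphi$ has compact support; * for each $y$ there is a finite set $S\subset\mathbb R$ such that $\widetilde G(\tau x,\tau y)-\widetilde G(x,y)$ tends to $S$ as $x$ leaves every compact set (so that this difference tends to a constant along each end). Assume finally that the Robin function $\widetilde R(x)=\lim_{y\to x}\bigl(\widetilde G(x,y)-\frac1{2\pi}\log d(x,y)\bigr)$ exists for every $x\in\widetilde M$, where $d$ is the geodesic distance. Put $$G_M(x',y')=\widetilde G(x',y')-\widetilde G(x',\tau y')\qquad(x',y'\in\widetilde M).$$ Then: 1. $G_M$ is a twisted Green's function of the Laplacian on $M$: for $\pi(x')\ne\pi(y')$ it is symmetric and satisfies $G_M(\tau x',y')=-G_M(x',y')=G_M(x',\tau y')$; $G_M(\cdot,y')$ is smooth off $\{y',\tau y'\}$, is locally integrable together with its gradient, and $\Delta G_M(\cdot,y')=\delta_{y'}-\delta_{\tau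 y'}$ in the sense of distributions on $\widetilde M$. 2. There is a (regular) function $R_M:M\to\mathbb R$ with $R_M(\pi(x'))=\widetilde R(x')-\widetilde G(x',\tau x')$ for all $x'\in\widetilde M$, and it is the Robin function of $G_M$: $$R_M(\pi(x'))=\lim_{y'\to x'}\Bigl(G_M(x',y')-\tfrac1{2\pi}\log d(x',y')\Bigr),$$ where $d(x',y')$ may be taken to be either the geodesic distance of $\widetilde M$ or the geodesic distance of $\pi(x')$ and $\pi(y')$ in $M$. 3. Let $x_1',\dots,x_N'\in\widetilde M$ have pairwise distinct projections $x_j=\pi(x_j')$, and let $\Gamma_1,\dots,\Gamma_N\in\mathbb R$. Half of the Hamiltonian (formed with $\widetilde G,\widetilde R$ in the standard form $-\sum_{i<j}\Gamma_i\Gamma_j\widetilde G(z_i,z_j)-\frac12\sum_j\Gamma_j^2\widetilde R(z_j)$) of the $2N$ vortices of strengths $\Gamma_j$ at $x_j'$ and $-\Gamma_j$ at $\tau x_j'$ on $\widetilde M$ equals $$\mathcal H=-\sum_{i<j}\Gamma_i\Gamma_j\,G_M(x_i',x_j')-\tfrac12\sum_j\Gamma_j^2R_M(x_j),$$ and $\mathcal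 H$ is unchanged when, for some $k$, the lift $x_k'$ is replaced by $\tau x_k'$ and $\Gamma_k$ by $-\Gamma_k$. -/

import Mathlib

open Set Filter Topology MeasureTheory Manifold Bundle
open scoped ContDiff

noncomputable section

/-- The model plane of surfaces. -/
abbrev Plane : Type := EuclideanSpace ℝ (Fin 2)

/-! ### Orientations and orientation double covers of surfaces -/

section Orientation

variable (M : Type*) [TopologicalSpace M] [ChartedSpace Plane M]

/-- A choice of an orientation of every tangent plane of the surface `M`. -/
abbrev OrientationField : Type _ :=
  ∀ x : M, Orientation ℝ (TangentSpace (𝓡 2) x) (Fin 2)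

variable {M} [IsManifold (𝓡 2) ∞ M]

/-- A field of orientations is continuous if, read in the local trivializations of the tangent
bundle that come from the charts, it is locally constant. -/
def OrientationField.IsContinuous (o : OrientationField M) : Prop :=
  ∀ x₀ : M, ∃ O : Orientation ℝ Plane (Fin 2), ∀ᶠ x in 𝓝 x₀,
    ∀ hx : x ∈ (trivializationAt Plane (TangentSpace (𝓡 2) (M := M)) x₀).baseSet,
      Orientation.map (Fin 2)
        ((trivializationAt Plane (TangentSpace (𝓡 2) (M := M)) x₀).continuousLinearEquivAt
          ℝ x hx).toLinearEquiv (o x) = O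

variable (M) in
/-- The surface `M` is orientable: it carries a continuous field of orientations. -/
def IsOrientableSurface : Prop := ∃ o : OrientationField M, o.IsContinuous

end Orientation

section Cover

variable {M N : Type*}
  [TopologicalSpace M] [ChartedSpace Plane M] [IsManifold (𝓡 2) ∞ M]
  [RiemannianBundle (fun x : M => TangentSpace (𝓡 2) x)]
  [TopologicalSpace N] [ChartedSpace Plane N] [IsManifold (𝓡 2) ∞ N]
  [RiemannianBundle (fun x : N => TangentSpace (𝓡 2) x)]

/-- `p : N → M` is the (Riemannian) orientation double cover of the surface `M`, with tautological
orientation `o` on `N` and with `τ` the automorphism that swaps the two points of each fibre.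
The two points `x`, `τ x` over `p x` carry the two opposite orientations of the tangent plane
of `M` there, so `x ↦ (p x, p_* (o x))` identifies `N` with the set of pairs
(point of `M`, orientation at that point). -/
structure IsOrientationDoubleCover (p : N → M) (τ : N → N) (o : OrientationField N) : Prop where
  isCoveringMap : IsCoveringMap p
  surjective : Function.Surjective p
  isLocalDiffeomorph : IsLocalDiffeomorph (𝓡 2) (𝓡 2) ∞ p
  /-- The metric of `N` is the pull-back of the metric of `M`. -/
  inner_mfderiv : ∀ (x : N) (v w : TangentSpace (𝓡 2) x),
    inner ℝ (mfderiv (𝓡 2) (𝓡 2) p x v) (mfderiv (𝓡 2) (𝓡 2) p x w) = inner ℝ v w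
  continuous_swap : Continuous τ
  swap_ne : ∀ x, τ x ≠ x
  fibre : ∀ x y, p y = p x ↔ y = x ∨ y = τ x
  orientation_continuous : o.IsContinuous
  /-- `dτ` reverses the orientation. -/
  swap_reverses : ∀ x, ∃ e : TangentSpace (𝓡 2) x ≃ₗ[ℝ] TangentSpace (𝓡 2) (τ x),
    (∀ v, e v = mfderiv (𝓡 2) (𝓡 2) τ x v) ∧ Orientation.map (Fin 2) e (o x) = -o (τ x)

end Cover

/-! ### The Laplacian, Green's functions and Robin functions on a Riemannian surface -/

section Green

variable {N : Type*} [EMetricSpace N] [ChartedSpace Plane N]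
  [RiemannianBundle (fun x : N => TangentSpace (𝓡 2) x)]

/-- The Riemannian gradient of a function on a surface. -/
def surfaceGradient (u : N → ℝ) (x : N) : TangentSpace (𝓡 2) x :=
  haveI : FiniteDimensional ℝ (TangentSpace (𝓡 2) x) :=
    inferInstanceAs (FiniteDimensional ℝ Plane)
  haveI : CompleteSpace (TangentSpace (𝓡 2) x) := FiniteDimensional.complete ℝ _
  (InnerProductSpace.toDual ℝ (TangentSpace (𝓡 2) x)).symm (mfderiv (𝓡 2) 𝓘(ℝ, ℝ) u x)

/-- The geodesic distance, as a real number. -/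
def geodesicDist {X : Type*} [EMetricSpace X] (x y : X) : ℝ := (edist x y).toReal

variable [MeasurableSpace N] [BorelSpace N]

variable (N) in
/-- The Riemannian area: the two-dimensional Hausdorff measure of the geodesic distance, normalized
so that it is Lebesgue measure on the Euclidean plane. -/
abbrev surfaceArea : Measure N := μHE[2]

/-- `Δ u = T` in the sense of distributions, for a function `u` that is locally integrable together
with its gradient: `- ∫ ⟨∇u, ∇φ⟩ dA = T φ` for all compactly supported smooth `φ`. -/
structure HasWeakLaplacian (u : N → ℝ) (T : (N → ℝ) → ℝ) : Prop where
  locallyIntegrable : LocallyIntegrable u (surfaceArea N)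
  locallyIntegrable_gradient : LocallyIntegrable (fun x => ‖surfaceGradient u x‖) (surfaceArea N)
  eq : ∀ φ : N → ℝ, ContMDiff (𝓡 2) 𝓘(ℝ, ℝ) ∞ φ → HasCompactSupport φ →
    -∫ x, inner ℝ (surfaceGradient u x) (surfaceGradient φ x) ∂(surfaceArea N) = T φ

open Classical in
variable (N) in
/-- The constant background vorticity: the reciprocal of the total area on a closed surface,
and zero on a noncompact surface. -/
def backgroundVorticity : ℝ :=
  if CompactSpace N then ((surfaceArea N) univ).toReal⁻¹ else 0

/-- `G` is a Green's function of the Laplacian: it is symmetric, smooth away from the diagonal,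
and `Δ G(·, y) = δ_y - κ` with `κ = 1 / Area` on a closed surface and `κ = 0` otherwise. -/
structure IsGreenFunction (G : N → N → ℝ) : Prop where
  symm : ∀ x y, G x y = G y x
  smooth : ∀ y, ContMDiffOn (𝓡 2) 𝓘(ℝ, ℝ) ∞ (fun x => G x y) {y}ᶜ
  laplacian : ∀ y, HasWeakLaplacian (fun x => G x y)
    (fun φ => φ y - backgroundVorticity N * ∫ x, φ x ∂(surfaceArea N))

/-- The circulation at infinity of the flow with stream function `G(·, y)`. For a smooth `φ` that
takes a constant value `φ_e` near each end `e` of the surface (`dφ` has compact support), on a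
noncompact surface, this is the sum over the ends of `φ_e` times the circulation around `e`
(the flux of `∇ G(·, y)` through `e`). -/
def endCirculation (G : N → N → ℝ) (y : N) (φ : N → ℝ) : ℝ :=
  φ y + ∫ x, inner ℝ (surfaceGradient (fun z => G z y) x) (surfaceGradient φ x) ∂(surfaceArea N)

/-- The hydrodynamic conditions imposed on `G` at the ends (or boundary components) of the surface
are symmetric under the involution `τ`: the circulation of `G(·, τ y)` around the end `τ e` is the
circulation of `G(·, y)` around `e`, and near each end the stream functions `G(·, y)` and
`G(τ ·, τ y)` differ by a function that tends to a constant (with finitely many constants in all). -/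
structure HasSymmetricEnds (τ : N → N) (G : N → N → ℝ) : Prop where
  circulation : ∀ (y : N) (φ : N → ℝ), ContMDiff (𝓡 2) 𝓘(ℝ, ℝ) ∞ φ →
    (∃ K : Set N, IsCompact K ∧ ∀ x ∉ K, mfderiv (𝓡 2) 𝓘(ℝ, ℝ) φ x = 0) →
      endCirculation G (τ y) (φ ∘ τ) = endCirculation G y φ
  streamline : ∀ y : N, ∃ S : Set ℝ, S.Finite ∧
    Tendsto (fun x => G (τ x) (τ y) - G x y) (cocompact N) (𝓝ˢ S)

/-- `R` is the Robin function of the kernel `G` on `N`, where the logarithmic singularity is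
measured with the distance function `d`. -/
def IsRobinFunction (d : N → N → ℝ) (G : N → N → ℝ) (R : N → ℝ) : Prop :=
  ∀ x, Tendsto (fun y => G x y - 1 / (2 * Real.pi) * Real.log (d x y)) (𝓝[≠] x) (𝓝 (R x))

/-- `K` is a twisted Green's function of the Laplacian on the quotient of `N` by the involution
`τ`: it is symmetric, changes sign when `τ` is applied to one of the variables, is smooth away from
the singularities, and `Δ K(·, y)` is the twisted delta function `δ_y - δ_{τ y}`. -/
structure IsTwistedGreenFunction (τ : N → N) (K : N → N → ℝ) : Prop where
  symm : ∀ x y, x ≠ y → x ≠ τ y → K x y = K y x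
  twisted_left : ∀ x y, x ≠ y → x ≠ τ y → K (τ x) y = -K x y
  twisted_right : ∀ x y, x ≠ y → x ≠ τ y → K x (τ y) = -K x y
  smooth : ∀ y, ContMDiffOn (𝓡 2) 𝓘(ℝ, ℝ) ∞ (fun x => K x y) {y, τ y}ᶜ
  laplacian : ∀ y, HasWeakLaplacian (fun x => K x y) (fun φ => φ y - φ (τ y))

end Green

/-! ### The functions on the quotient and the Hamiltonian -/

/-- The kernel `G_M(x, y) = G(x', y') - G(x', τ y')`, as a function of the lifts. -/
def twistedGreen {N : Type*} (τ : N → N) (G : N → N → ℝ) (x y : N) : ℝ := G x y - G x (τ y)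

/-- The Hamiltonian of the point vortices at `x₁, …, xₙ` with strengths `Γ₁, …, Γₙ` in its standard
form: `- ∑_{i < j} Γᵢ Γⱼ G(xᵢ, xⱼ) - ½ ∑ⱼ Γⱼ² R(xⱼ)`. -/
def vortexHamiltonian {N : Type*} (G : N → N → ℝ) (R : N → ℝ) {n : ℕ}
    (Γ : Fin n → ℝ) (x : Fin n → N) : ℝ :=
  -(∑ i, ∑ j ∈ Finset.Ioi i, Γ i * Γ j * G (x i) (x j)) - 1 / 2 * ∑ j, Γ j ^ 2 * R (x j)

end

/-! Everything follows from two invariances, `G (τ x) (τ y) = G x y` for `x ≠ y` and `R ∘ τ = R`;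
given these, the three assertions are algebra together with the regularity of `G` at the points `(x,
τ x)`.

To get them, fix `y` and consider `u = G (τ ·) (τ y) - G · y`. As `τ` is an isometry, the
logarithmic poles at `y` cancel, and `u` extends continuously to `y` by `R (τ y) - R y`
(`tendsto_green_swap_sub`). The gradient of `u` is orthogonal to the gradient of every smooth `φ`
with `dφ` compactly supported: on a closed surface the background terms agree because `τ` preserves
area, otherwise this is the symmetry of the circulations
(`integral_inner_surfaceGradient_green_swap_eq`). Finally `u` tends to a finite set of values at
infinity.

Such a `u` is constant (`exists_eq_const_of_weakly_harmonic`). If `c` is a value of `u` other than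
`u y` and the values at infinity, test with `φ = F ∘ u`, where `F'` is a bump at `c`: then `φ` is
constant near `y` and outside a compact set, hence admissible although `u` is only continuous at
`y`, and `∫ F'(u) |∇u|² = 0` forces `∇u = 0` wherever `u` is close to `c`. So the level set of `c`
is clopen. If there is no such `c`, then `u` has finite range. Either way connectedness of `N`
concludes; neither elliptic regularity nor removal of singularities enters. The constant `R (τ y) -
R y` is zero because `u (τ y) = G y (τ y) - G (τ y) y = 0`.

`N` is connected because a proper nonempty clopen subset would contain exactly one point of each
fibre, giving a smooth section of `p` along which the orientation of `N` pulls back to `M`. -/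

/-! ### Lipschitz estimates on Riemannian manifolds -/

section Lipschitz

open scoped NNReal ENNReal

variable {E : Type*} [NormedAddCommGroup E] [NormedSpace ℝ E] {H : Type*} [TopologicalSpace H]
  {I : ModelWithCorners ℝ E H} {X : Type*} [PseudoEMetricSpace X] [ChartedSpace H X]
  [RiemannianBundle (fun x : X => TangentSpace I x)] [IsRiemannianManifold I X]
  {E' : Type*} [NormedAddCommGroup E'] [NormedSpace ℝ E'] {H' : Type*} [TopologicalSpace H']
  {I' : ModelWithCorners ℝ E' H'} {Y : Type*} [PseudoEMetricSpace Y] [ChartedSpace H' Y]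
  [RiemannianBundle (fun x : Y => TangentSpace I' x)] [IsRiemannianManifold I' Y]

/-- A path of length less than `r` stays in the ball of radius `r` around its starting point. -/
theorem edist_lt_of_pathELength_lt {γ : ℝ → X} (hγ : ContMDiffOn 𝓘(ℝ, ℝ) I 1 γ (Icc 0 1)) {r : ℝ≥0∞}
    (hr : pathELength I γ 0 1 < r) {t : ℝ} (ht : t ∈ Icc (0 : ℝ) 1) : edist (γ 0) (γ t) < r := by
  rw [IsRiemannianManifold.out (I := I)]
  refine lt_of_le_of_lt ?_ hr
  refine (riemannianEDist_le_pathELength (hγ.mono (Icc_subset_Icc_right ht.2)) rfl rfl ht.1).trans ?_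
  exact pathELength_mono le_rfl ht.2

/-- A map whose derivative is bounded by `C` on a ball expands the distances from the centre by at
most the factor `C`. -/
theorem edist_map_le_of_enorm_mfderiv_le {f : X → Y} {U : Set X} (hU : IsOpen U)
    (hf : ContMDiffOn I I' 1 f U) {C : ℝ≥0}
    (hC : ∀ z ∈ U, ∀ v : TangentSpace I z, ‖mfderiv I I' f z v‖ₑ ≤ C * ‖v‖ₑ) {x y : X} {r : ℝ≥0∞}
    (hr : ∀ z, edist x z < r → z ∈ U) (hxy : edist x y < r) :
    edist (f x) (f y) ≤ C * edist x y := by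
  -- Nearly minimizing paths are used, since minimizers need not exist: a path from `x` shorter than
  -- `L ≤ r` cannot leave the ball, so the derivative bound holds all along it. Then `L` decreases
  -- to the distance.
  have key : ∀ L, edist x y < L → L ≤ r → edist (f x) (f y) ≤ C * L := by
    intro L hL hLr
    rw [IsRiemannianManifold.out (I := I)] at hL
    obtain ⟨γ, h0, h1, hγ, hlen⟩ := exists_lt_of_riemannianEDist_lt hL
    have hmem : ∀ t ∈ Icc (0 : ℝ) 1, γ t ∈ U := fun t ht =>
      hr _ (h0 ▸ (edist_lt_of_pathELength_lt hγ hlen ht).trans_le hLr)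
    have hfγ : ContMDiffOn 𝓘(ℝ, ℝ) I' 1 (f ∘ γ) (Icc 0 1) := hf.comp hγ hmem
    rw [IsRiemannianManifold.out (I := I')]
    refine (riemannianEDist_le_pathELength hfγ (by simp [h0]) (by simp [h1]) zero_le_one).trans ?_
    refine le_trans ?_ (mul_le_mul_right hlen.le _)
    rw [pathELength_eq_lintegral_mfderiv_Ioo, pathELength_eq_lintegral_mfderiv_Ioo,
      ← lintegral_const_mul' _ _ ENNReal.coe_ne_top]
    refine setLIntegral_mono' measurableSet_Ioo fun t ht => ?_
    have hγt : MDifferentiableAt 𝓘(ℝ, ℝ) I γ t :=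
      (hγ.contMDiffAt (Icc_mem_nhds ht.1 ht.2)).mdifferentiableAt one_ne_zero
    have hft : MDifferentiableAt I I' f (γ t) :=
      (hf.contMDiffAt (hU.mem_nhds (hmem t (Ioo_subset_Icc_self ht)))).mdifferentiableAt one_ne_zero
    rw [mfderiv_comp t hft hγt]
    exact hC _ (hmem t (Ioo_subset_Icc_self ht)) _
  have hne : (𝓝[>] (edist x y)).NeBot := nhdsGT_neBot_of_exists_gt ⟨r, hxy⟩
  have hlim : Tendsto (fun L : ℝ≥0∞ => C * L) (𝓝[>] (edist x y)) (𝓝 (C * edist x y)) :=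
    (ENNReal.Tendsto.const_mul tendsto_id (Or.inr ENNReal.coe_ne_top)).mono_left nhdsWithin_le_nhds
  refine ge_of_tendsto hlim ?_
  filter_upwards [Ioc_mem_nhdsGT hxy] with L hL using key L hL.1 hL.2

/-- A function whose derivative vanishes near a point is constant near that point. -/
theorem eventually_eq_of_mfderiv_eq_zero {f : X → ℝ} {x : X}
    (hf : ∀ᶠ z in 𝓝 x, ContMDiffAt I 𝓘(ℝ, ℝ) 1 f z ∧ mfderiv I 𝓘(ℝ, ℝ) f z = 0) :
    ∀ᶠ z in 𝓝 x, f z = f x := by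
  obtain ⟨U, hUsub, hU, hxU⟩ := eventually_nhds_iff.1 hf
  obtain ⟨r, hr0, hr⟩ := EMetric.mem_nhds_iff.1 (hU.mem_nhds hxU)
  have h1 : ContMDiffOn I 𝓘(ℝ, ℝ) 1 f U := fun z hz => (hUsub z hz).1.contMDiffWithinAt
  filter_upwards [Metric.eball_mem_nhds x hr0] with y hy
  -- With zero derivative the expansion factor can be taken to be `0`.
  have h2 := edist_map_le_of_enorm_mfderiv_le (I := I) (I' := 𝓘(ℝ, ℝ)) (C := 0) hU h1
    (fun z hz v => by rw [(hUsub z hz).2]; simp) (x := x) (y := y) (r := r)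
    (fun z hz => hr (by simpa [Metric.mem_eball, edist_comm] using hz))
    (by simpa [Metric.mem_eball, edist_comm] using hy)
  have h3 : edist (f x) (f y) = 0 := by simpa using h2
  exact (edist_eq_zero.1 h3).symm

end Lipschitz

/-! ### The Riemannian gradient -/

section Gradient

/-- Strict Cauchy–Schwarz: the component of `b 1` orthogonal to `b 0`, scaled by `|b 0|²`, is
nonzero, and its squared length is `|b 0|²` times the Gram determinant. -/
theorem gram_det_pos {V : Type*} [NormedAddCommGroup V] [InnerProductSpace ℝ V]
    (b : Module.Basis (Fin 2) ℝ V) :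
    0 < inner ℝ (b 0) (b 0) * inner ℝ (b 1) (b 1) - (inner ℝ (b 0) (b 1) : ℝ) ^ 2 := by
  have h0 : 0 < (inner ℝ (b 0) (b 0) : ℝ) := real_inner_self_pos.2 (b.ne_zero 0)
  set w := (inner ℝ (b 0) (b 0) : ℝ) • b 1 - (inner ℝ (b 0) (b 1) : ℝ) • b 0 with hw
  have hw0 : w ≠ 0 := by
    intro h
    have h3 := congrArg (fun z => b.repr z 1) h
    simp [hw] at h3
    exact b.ne_zero 0 h3
  have h1 : 0 < (inner ℝ w w : ℝ) := real_inner_self_pos.2 hw0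
  have h2 : (inner ℝ w w : ℝ) = inner ℝ (b 0) (b 0) *
      (inner ℝ (b 0) (b 0) * inner ℝ (b 1) (b 1) - (inner ℝ (b 0) (b 1) : ℝ) ^ 2) := by
    simp only [hw, inner_sub_left, inner_sub_right, real_inner_smul_left, real_inner_smul_right,
      real_inner_comm (b 0) (b 1)]
    ring
  rw [h2] at h1
  exact (mul_pos_iff_of_pos_left h0).1 h1

/-- The inner product of two vectors of a Euclidean plane in terms of their inner products with
the vectors of a basis. -/
theorem inner_eq_gram_div {V : Type*} [NormedAddCommGroup V] [InnerProductSpace ℝ V]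
    (b : Module.Basis (Fin 2) ℝ V) (v w : V) :
    inner ℝ v w =
      (inner ℝ (b 1) (b 1) * (inner ℝ v (b 0) * inner ℝ w (b 0))
        - inner ℝ (b 0) (b 1) * (inner ℝ v (b 0) * inner ℝ w (b 1) + inner ℝ v (b 1) * inner ℝ w (b 0))
        + inner ℝ (b 0) (b 0) * (inner ℝ v (b 1) * inner ℝ w (b 1)))
        / (inner ℝ (b 0) (b 0) * inner ℝ (b 1) (b 1) - inner ℝ (b 0) (b 1) ^ 2) := by
  have hpos := gram_det_pos b
  have hv : b.repr v 0 • b 0 + b.repr v 1 • b 1 = v := by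
    rw [← Fin.sum_univ_two (fun i => b.repr v i • b i), b.sum_repr]
  have hw : b.repr w 0 • b 0 + b.repr w 1 • b 1 = w := by
    rw [← Fin.sum_univ_two (fun i => b.repr w i • b i), b.sum_repr]
  rw [eq_div_iff hpos.ne', ← hv, ← hw]
  simp only [inner_add_left, inner_add_right, real_inner_smul_left, real_inner_smul_right,
    real_inner_comm (b 0) (b 1)]
  ring

variable {N : Type*} [EMetricSpace N] [ChartedSpace Plane N]
  [RiemannianBundle (fun x : N => TangentSpace (𝓡 2) x)]

theorem inner_surfaceGradient (u : N → ℝ) (x : N) (v : TangentSpace (𝓡 2) x) :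
    inner ℝ (surfaceGradient u x) v = mfderiv (𝓡 2) 𝓘(ℝ, ℝ) u x v := by
  have : FiniteDimensional ℝ (TangentSpace (𝓡 2) x) :=
    inferInstanceAs (FiniteDimensional ℝ Plane)
  have : CompleteSpace (TangentSpace (𝓡 2) x) := FiniteDimensional.complete ℝ _
  exact InnerProductSpace.toDual_symm_apply

theorem surfaceGradient_unique {u : N → ℝ} {x : N} {w : TangentSpace (𝓡 2) x}
    (h : ∀ v, inner ℝ w v = mfderiv (𝓡 2) 𝓘(ℝ, ℝ) u x v) : surfaceGradient u x = w :=
  ext_inner_right ℝ fun v => by rw [inner_surfaceGradient, h]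

theorem surfaceGradient_eq_zero_iff {u : N → ℝ} {x : N} :
    surfaceGradient u x = 0 ↔ mfderiv (𝓡 2) 𝓘(ℝ, ℝ) u x = 0 := by
  constructor
  · intro h
    ext v
    have := inner_surfaceGradient u x v
    rw [h, inner_zero_left] at this
    exact this.symm
  · intro h
    refine surfaceGradient_unique fun v => ?_
    rw [h, inner_zero_left]
    rfl

theorem surfaceGradient_sub {u v : N → ℝ} {x : N} (hu : MDifferentiableAt (𝓡 2) 𝓘(ℝ, ℝ) u x)
    (hv : MDifferentiableAt (𝓡 2) 𝓘(ℝ, ℝ) v x) :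
    surfaceGradient (fun z => u z - v z) x = surfaceGradient u x - surfaceGradient v x := by
  refine surfaceGradient_unique fun w => ?_
  have h := (hu.hasMFDerivAt.sub hv.hasMFDerivAt).mfderiv
  rw [inner_sub_left, inner_surfaceGradient, inner_surfaceGradient]
  exact (congrArg (fun L => L w) h).symm

theorem surfaceGradient_comp {F : ℝ → ℝ} {u : N → ℝ} {x : N} (hF : DifferentiableAt ℝ F (u x))
    (hu : MDifferentiableAt (𝓡 2) 𝓘(ℝ, ℝ) u x) :
    surfaceGradient (fun z => F (u z)) x = deriv F (u x) • surfaceGradient u x := by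
  refine surfaceGradient_unique fun w => ?_
  have h : mfderiv (𝓡 2) 𝓘(ℝ, ℝ) (F ∘ u) x
      = (mfderiv 𝓘(ℝ, ℝ) 𝓘(ℝ, ℝ) F (u x)).comp (mfderiv (𝓡 2) 𝓘(ℝ, ℝ) u x) :=
    mfderiv_comp x hF.mdifferentiableAt hu
  have h' : (mfderiv (𝓡 2) 𝓘(ℝ, ℝ) (F ∘ u) x w : ℝ)
      = fderiv ℝ F (u x) (mfderiv (𝓡 2) 𝓘(ℝ, ℝ) u x w : ℝ) := by
    rw [h, mfderiv_eq_fderiv]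
    rfl
  rw [real_inner_smul_left, inner_surfaceGradient]
  refine Eq.trans ?_ h'.symm
  have h3 : ∀ a : ℝ, deriv F (u x) * a = fderiv ℝ F (u x) a := fun a => by
    rw [fderiv_eq_smul_deriv, smul_eq_mul, mul_comm]
  exact h3 _

theorem surfaceGradient_congr {u v : N → ℝ} {x : N} (h : u =ᶠ[𝓝 x] v) :
    surfaceGradient u x = surfaceGradient v x :=
  surfaceGradient_unique fun w => by
    rw [inner_surfaceGradient, h.mfderiv_eq]
    rfl

variable [IsManifold (𝓡 2) ∞ N]

omit [RiemannianBundle (fun x : N => TangentSpace (𝓡 2) x)] in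
/-- The derivative of a smooth function along a continuous vector field is continuous. -/
theorem ContMDiffOn.continuousOn_mfderiv_apply {u : N → ℝ} {s : Set N} (hs : IsOpen s)
    (hu : ContMDiffOn (𝓡 2) 𝓘(ℝ, ℝ) ∞ u s) {e : ∀ x : N, TangentSpace (𝓡 2) x} {t : Set N}
    (he : ContinuousOn (fun x => (⟨x, e x⟩ : TotalSpace Plane (TangentSpace (𝓡 2) (M := N)))) t) :
    ContinuousOn (fun x => (mfderiv (𝓡 2) 𝓘(ℝ, ℝ) u x (e x) : ℝ)) (s ∩ t) := by
  have h1 := hu.continuousOn_tangentMapWithin (by simp) hs.uniqueMDiffOn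
  have h2 : ContinuousOn (fun x => tangentMapWithin (𝓡 2) 𝓘(ℝ, ℝ) u s ⟨x, e x⟩) (s ∩ t) :=
    h1.comp (he.mono inter_subset_right) (fun x hx => hx.1)
  have h3 : Continuous (fun q : TangentBundle 𝓘(ℝ, ℝ) ℝ => (q.2 : ℝ)) :=
    continuous_snd.comp (tangentBundleModelSpaceHomeomorph 𝓘(ℝ, ℝ)).continuous
  refine (h3.comp_continuousOn h2).congr fun x hx => ?_
  change mfderiv (𝓡 2) 𝓘(ℝ, ℝ) u x (e x) = mfderivWithin (𝓡 2) 𝓘(ℝ, ℝ) u s x (e x)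
  rw [mfderivWithin_of_isOpen hs hx.1]

theorem isContinuousRiemannianBundle_tangentSpace
    [IsContMDiffRiemannianBundle (𝓡 2) ∞ Plane (fun x : N => TangentSpace (𝓡 2) x)] :
    IsContinuousRiemannianBundle Plane (fun x : N => TangentSpace (𝓡 2) x) := by
  obtain ⟨g, hg, hg'⟩ := IsContMDiffRiemannianBundle.exists_contMDiff (IB := 𝓡 2) (n := ∞)
    (F := Plane) (E := fun x : N => TangentSpace (𝓡 2) x)
  exact ⟨g, hg.continuous, hg'⟩

variable [IsContMDiffRiemannianBundle (𝓡 2) ∞ Plane (fun x : N => TangentSpace (𝓡 2) x)]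

/-- In a local frame the pairing is a rational function of the derivatives of `u` and `v` along the
frame and of the metric coefficients, all continuous, with the Gram determinant as denominator. This
avoids treating the gradient itself as a continuous section. -/
theorem continuousOn_inner_surfaceGradient {u v : N → ℝ} {s : Set N} (hs : IsOpen s)
    (hu : ContMDiffOn (𝓡 2) 𝓘(ℝ, ℝ) ∞ u s) (hv : ContMDiffOn (𝓡 2) 𝓘(ℝ, ℝ) ∞ v s) :
    ContinuousOn (fun x => (inner ℝ (surfaceGradient u x) (surfaceGradient v x) : ℝ)) s := by
  intro x₀ hx₀
  refine ContinuousAt.continuousWithinAt ?_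
  set e := trivializationAt Plane (TangentSpace (𝓡 2) (M := N)) x₀ with he
  let b := (EuclideanSpace.basisFun (Fin 2) ℝ).toBasis
  have hx₀e : x₀ ∈ e.baseSet := FiberBundle.mem_baseSet_trivializationAt' x₀
  have hfr : ∀ i, ContinuousOn (fun x => (⟨x, e.localFrame b i x⟩ :
      TotalSpace Plane (TangentSpace (𝓡 2) (M := N)))) e.baseSet := fun i =>
    (e.contMDiffOn_localFrame_baseSet (I := 𝓡 2) ∞ b i).continuousOn
  have hnhds : s ∩ e.baseSet ∈ 𝓝 x₀ :=
    inter_mem (hs.mem_nhds hx₀) (e.open_baseSet.mem_nhds hx₀e)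
  have hdu : ∀ i, ContinuousAt (fun x =>
      (inner ℝ (surfaceGradient u x) (e.localFrame b i x) : ℝ)) x₀ := fun i => by
    simp only [inner_surfaceGradient]
    exact (hu.continuousOn_mfderiv_apply hs (hfr i)).continuousAt hnhds
  have hdv : ∀ i, ContinuousAt (fun x =>
      (inner ℝ (surfaceGradient v x) (e.localFrame b i x) : ℝ)) x₀ := fun i => by
    simp only [inner_surfaceGradient]
    exact (hv.continuousOn_mfderiv_apply hs (hfr i)).continuousAt hnhds
  have hg : ∀ i j, ContinuousAt (fun x =>
      (inner ℝ (e.localFrame b i x) (e.localFrame b j x) : ℝ)) x₀ := fun i j =>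
    have := isContinuousRiemannianBundle_tangentSpace (N := N)
    ContinuousAt.inner_bundle ((hfr i).continuousAt (e.open_baseSet.mem_nhds hx₀e))
      ((hfr j).continuousAt (e.open_baseSet.mem_nhds hx₀e))
  have hloc : ∀ x ∈ e.baseSet, ∃ B : Module.Basis (Fin 2) ℝ (TangentSpace (𝓡 2) x),
      ∀ i, B i = e.localFrame b i x := fun x hx =>
    ⟨e.basisAt b hx, fun i => (e.localFrame_apply_of_mem_baseSet b hx).symm⟩
  have hdet : inner ℝ (e.localFrame b 0 x₀) (e.localFrame b 0 x₀)
      * inner ℝ (e.localFrame b 1 x₀) (e.localFrame b 1 x₀)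
      - (inner ℝ (e.localFrame b 0 x₀) (e.localFrame b 1 x₀) : ℝ) ^ 2 ≠ 0 := by
    obtain ⟨B, hB⟩ := hloc x₀ hx₀e
    rw [← hB, ← hB]
    exact (gram_det_pos B).ne'
  refine ContinuousAt.congr (f := fun x =>
      (inner ℝ (e.localFrame b 1 x) (e.localFrame b 1 x)
        * (inner ℝ (surfaceGradient u x) (e.localFrame b 0 x)
          * inner ℝ (surfaceGradient v x) (e.localFrame b 0 x))
        - inner ℝ (e.localFrame b 0 x) (e.localFrame b 1 x)
        * (inner ℝ (surfaceGradient u x) (e.localFrame b 0 x)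
          * inner ℝ (surfaceGradient v x) (e.localFrame b 1 x)
          + inner ℝ (surfaceGradient u x) (e.localFrame b 1 x)
          * inner ℝ (surfaceGradient v x) (e.localFrame b 0 x))
        + inner ℝ (e.localFrame b 0 x) (e.localFrame b 0 x)
        * (inner ℝ (surfaceGradient u x) (e.localFrame b 1 x)
          * inner ℝ (surfaceGradient v x) (e.localFrame b 1 x)))
        / (inner ℝ (e.localFrame b 0 x) (e.localFrame b 0 x)
          * inner ℝ (e.localFrame b 1 x) (e.localFrame b 1 x)
          - (inner ℝ (e.localFrame b 0 x) (e.localFrame b 1 x) : ℝ) ^ 2)) ?_ ?_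
  · exact ((((hg 1 1).mul ((hdu 0).mul (hdv 0))).sub
      ((hg 0 1).mul (((hdu 0).mul (hdv 1)).add ((hdu 1).mul (hdv 0))))).add
      ((hg 0 0).mul ((hdu 1).mul (hdv 1)))).div
      (((hg 0 0).mul (hg 1 1)).sub ((hg 0 1).pow 2)) hdet
  · filter_upwards [e.open_baseSet.mem_nhds hx₀e] with x hx
    obtain ⟨B, hB⟩ := hloc x hx
    rw [inner_eq_gram_div B (surfaceGradient u x) (surfaceGradient v x), hB, hB]

theorem continuousOn_norm_surfaceGradient {u : N → ℝ} {s : Set N} (hs : IsOpen s)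
    (hu : ContMDiffOn (𝓡 2) 𝓘(ℝ, ℝ) ∞ u s) :
    ContinuousOn (fun x => ‖surfaceGradient u x‖) s := by
  simp only [norm_eq_sqrt_real_inner]
  exact (continuousOn_inner_surfaceGradient hs hu hu).sqrt

end Gradient

/-! ### The Riemannian area -/

section Area

open scoped NNReal ENNReal

variable {N : Type*} [EMetricSpace N] [MeasurableSpace N] [BorelSpace N]

/-- Makes the poles negligible in all integrals below. -/
theorem nullSingletonClass_surfaceArea : NullSingletonClass (surfaceArea N) := by
  have := Measure.nullSingletonClass_hausdorff N (d := (2 : ℕ)) (by norm_num)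
  refine ⟨fun x => ?_⟩
  rw [surfaceArea, Measure.euclideanHausdorffMeasure_def, Measure.smul_apply, measure_singleton,
    smul_zero]

variable [ChartedSpace Plane N] [IsManifold (𝓡 2) ∞ N]
  [RiemannianBundle (fun x : N => TangentSpace (𝓡 2) x)]
  [IsContMDiffRiemannianBundle (𝓡 2) ∞ Plane (fun x : N => TangentSpace (𝓡 2) x)]
  [IsRiemannianManifold (𝓡 2) N]

omit [MeasurableSpace N] [BorelSpace N] in
theorem exists_lipschitzOnWith_extChartAt (x : N) {U : Set N} (hU : U ∈ 𝓝 x) :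
    ∃ (C : ℝ≥0), ∃ s ∈ 𝓝 x, s ⊆ U ∧ LipschitzOnWith C (extChartAt (𝓡 2) x) s := by
  have := isContinuousRiemannianBundle_tangentSpace (N := N)
  obtain ⟨C, -, hC⟩ := eventually_enorm_mfderiv_extChartAt_lt (𝓡 2) x
  obtain ⟨V, hVsub, hV, hxV⟩ := eventually_nhds_iff.1
    (hC.and (inter_mem hU (chart_source_mem_nhds Plane x)))
  obtain ⟨r, hr0, hr⟩ := EMetric.mem_nhds_iff.1 (hV.mem_nhds hxV)
  -- Two points of the ball of radius `r / 3` are less than `2r / 3` apart, and the ball of that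
  -- radius around either of them stays inside the ball of radius `r` around `x`, where the
  -- derivative is bounded.
  have hr3 : 0 < r / 3 := ENNReal.div_pos hr0.ne' (by norm_num)
  have hr3r : r / 3 ≤ r := by
    rw [ENNReal.div_eq_inv_mul]
    exact mul_le_of_le_one_left' (by norm_num)
  have hsum : r / 3 + (r / 3 + r / 3) = r := by
    rw [← add_assoc, ENNReal.add_thirds]
  refine ⟨C, Metric.eball x (r / 3), Metric.eball_mem_nhds x hr3, fun z hz => ?_, ?_⟩
  · exact (hVsub z (hr (Metric.eball_subset_eball hr3r hz))).2.1
  have hf : ContMDiffOn (𝓡 2) (𝓡 2) 1 (extChartAt (𝓡 2) x) V :=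
    (contMDiffOn_extChartAt (n := 1)).mono fun z hz => (hVsub z hz).2.2
  intro y hy z hz
  refine edist_map_le_of_enorm_mfderiv_le (I := 𝓡 2) (I' := 𝓡 2) hV hf (C := C) ?_
    (r := r / 3 + r / 3) ?_ ?_
  · intro w hw v
    have hw1 := (hVsub w hw).1
    let : NormedAddCommGroup (TangentSpace 𝓘(ℝ, Plane) (extChartAt (𝓡 2) x w)) :=
      normedAddCommGroupTangentSpaceVectorSpace _
    let : NormedSpace ℝ (TangentSpace 𝓘(ℝ, Plane) (extChartAt (𝓡 2) x w)) :=
      normedSpaceTangentSpaceVectorSpace _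
    rw [enorm_tangentSpace_vectorSpace]
    refine (ContinuousLinearMap.le_opENorm
      (mfderiv (𝓡 2) 𝓘(ℝ, Plane) (extChartAt (𝓡 2) x) w) v).trans ?_
    gcongr
    exact hw1.le
  · intro w hw
    refine hr ?_
    rw [Metric.mem_eball', ← hsum]
    refine (edist_triangle x y w).trans_lt (ENNReal.add_lt_add (Metric.mem_eball'.1 hy) hw)
  · exact (edist_triangle_left y z x).trans_lt
      (ENNReal.add_lt_add (Metric.mem_eball'.1 hy) (Metric.mem_eball'.1 hz))

/-- A chart is Lipschitz near its centre, so it would send a null open set to a null set of the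
plane; but the image is a neighbourhood of a point. This is what turns almost-everywhere vanishing
of a continuous integrand into vanishing. -/
theorem isOpenPosMeasure_surfaceArea : (surfaceArea N).IsOpenPosMeasure := by
  refine ⟨fun U hU hne h0 => ?_⟩
  obtain ⟨x, hx⟩ := hne
  obtain ⟨C, s, hs, hsU, hC⟩ := exists_lipschitzOnWith_extChartAt x (hU.mem_nhds hx)
  have h1 : μH[(2 : ℕ)] s = 0 := by
    have h2 : surfaceArea N s = 0 := measure_mono_null hsU h0
    rw [surfaceArea, Measure.euclideanHausdorffMeasure_def, Measure.smul_apply, ENNReal.smul_def,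
      smul_eq_mul, mul_eq_zero] at h2
    refine h2.resolve_left ?_
    simpa using Measure.addHaarScalarFactor_volume_hausdorffMeasure_ne_zero 2
  have h3 := hC.hausdorffMeasure_image_le (d := (2 : ℕ)) (by norm_num)
  rw [h1, mul_zero, nonpos_iff_eq_zero] at h3
  have h4 : extChartAt (𝓡 2) x '' s ∈ 𝓝 (extChartAt (𝓡 2) x x) := extChartAt_image_nhds_mem_nhds_of_boundaryless hs
  have h5 : (μHE[2] : Measure Plane) (extChartAt (𝓡 2) x '' s) = 0 := by
    rw [Measure.euclideanHausdorffMeasure_def, Measure.smul_apply, h3, smul_zero]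
  rw [EuclideanSpace.euclideanHausdorffMeasure_eq_volume] at h5
  exact (Measure.measure_pos_of_mem_nhds volume h4).ne' h5

omit [IsRiemannianManifold (𝓡 2) N] in
theorem aestronglyMeasurable_inner_surfaceGradient {u v : N → ℝ} {s : Set N} (hs : s.Finite)
    (hu : ContMDiffOn (𝓡 2) 𝓘(ℝ, ℝ) ∞ u sᶜ) (hv : ContMDiffOn (𝓡 2) 𝓘(ℝ, ℝ) ∞ v sᶜ) :
    AEStronglyMeasurable (fun x => (inner ℝ (surfaceGradient u x) (surfaceGradient v x) : ℝ))
      (surfaceArea N) := by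
  have := nullSingletonClass_surfaceArea (N := N)
  have h := (continuousOn_inner_surfaceGradient hs.isClosed.isOpen_compl hu hv).aestronglyMeasurable
    (μ := surfaceArea N) hs.measurableSet.compl
  have h2 : (surfaceArea N).restrict sᶜ = surfaceArea N := by
    refine Measure.restrict_eq_self_of_ae_mem ?_
    exact compl_mem_ae_iff.2 (hs.measure_zero _)
  rwa [h2] at h

omit [IsRiemannianManifold (𝓡 2) N] in
-- On `K` the gradient of `φ` is bounded, so `‖∇u‖` dominates; off `K` the integrand is zero. Only
-- `dφ` is compactly supported, which admits test functions with different constants at different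
-- ends.
theorem integrable_inner_surfaceGradient {u φ : N → ℝ} {s : Set N} (hs : s.Finite)
    (hu : ContMDiffOn (𝓡 2) 𝓘(ℝ, ℝ) ∞ u sᶜ)
    (hu' : LocallyIntegrable (fun x => ‖surfaceGradient u x‖) (surfaceArea N))
    (hφ : ContMDiff (𝓡 2) 𝓘(ℝ, ℝ) ∞ φ) {K : Set N} (hK : IsCompact K)
    (hφK : ∀ x ∉ K, mfderiv (𝓡 2) 𝓘(ℝ, ℝ) φ x = 0) :
    Integrable (fun x => (inner ℝ (surfaceGradient u x) (surfaceGradient φ x) : ℝ))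
      (surfaceArea N) := by
  have hcont : Continuous (fun x => ‖surfaceGradient φ x‖) :=
    continuousOn_univ.1 (continuousOn_norm_surfaceGradient isOpen_univ hφ.contMDiffOn)
  obtain ⟨C, hC⟩ := hK.exists_bound_of_continuousOn hcont.continuousOn
  have hmeas := aestronglyMeasurable_inner_surfaceGradient hs hu hφ.contMDiffOn
  have hon : IntegrableOn (fun x => (inner ℝ (surfaceGradient u x) (surfaceGradient φ x) : ℝ)) K
      (surfaceArea N) := by
    refine Integrable.mono' ((hu'.integrableOn_isCompact hK).const_mul C) hmeas.restrict ?_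
    filter_upwards [ae_restrict_mem hK.measurableSet] with x hx
    calc ‖(inner ℝ (surfaceGradient u x) (surfaceGradient φ x) : ℝ)‖
        ≤ ‖surfaceGradient u x‖ * ‖surfaceGradient φ x‖ := norm_inner_le_norm _ _
      _ ≤ ‖surfaceGradient u x‖ * C := by
          gcongr
          simpa using hC x hx
      _ = C * ‖surfaceGradient u x‖ := mul_comm _ _
  refine (integrableOn_iff_integrable_of_support_subset ?_).1 hon
  intro x hx
  by_contra hxK
  refine hx ?_
  simp only []
  rw [surfaceGradient_eq_zero_iff.2 (hφK x hxK), inner_zero_right]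

end Area

/-! ### Isometric maps -/

section Isometric

variable {N : Type*} [EMetricSpace N] [ChartedSpace Plane N]
  [RiemannianBundle (fun x : N => TangentSpace (𝓡 2) x)]

/-- The gradient is natural under a map with isometric and surjective derivative. -/
theorem inner_surfaceGradient_comp {τ : N → N} {x : N} (hτ : MDifferentiableAt (𝓡 2) (𝓡 2) τ x)
    (hiso : ∀ v w : TangentSpace (𝓡 2) x,
      inner ℝ (mfderiv (𝓡 2) (𝓡 2) τ x v) (mfderiv (𝓡 2) (𝓡 2) τ x w) = (inner ℝ v w : ℝ))
    {u v : N → ℝ} (hu : MDifferentiableAt (𝓡 2) 𝓘(ℝ, ℝ) u (τ x))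
    (hv : MDifferentiableAt (𝓡 2) 𝓘(ℝ, ℝ) v (τ x)) :
    (inner ℝ (surfaceGradient (u ∘ τ) x) (surfaceGradient (v ∘ τ) x) : ℝ) =
      inner ℝ (surfaceGradient u (τ x)) (surfaceGradient v (τ x)) := by
  have hsurj : Function.Surjective (mfderiv (𝓡 2) (𝓡 2) τ x) := by
    have hinj : Function.Injective (mfderiv (𝓡 2) (𝓡 2) τ x) := by
      refine (injective_iff_map_eq_zero _).2 fun v hv => ?_
      have := hiso v v
      rw [hv, inner_zero_left] at this
      exact inner_self_eq_zero.1 this.symm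
    have : FiniteDimensional ℝ (TangentSpace (𝓡 2) x) := inferInstanceAs (FiniteDimensional ℝ Plane)
    have : FiniteDimensional ℝ (TangentSpace (𝓡 2) (τ x)) :=
      inferInstanceAs (FiniteDimensional ℝ Plane)
    exact (LinearMap.injective_iff_surjective_of_finrank_eq_finrank
      (f := (mfderiv (𝓡 2) (𝓡 2) τ x).toLinearMap) rfl).1 hinj
  -- The derivative of `τ` carries the gradient of `u ∘ τ` to that of `u`; surjectivity allows
  -- testing against image vectors only.
  have key : ∀ {u : N → ℝ}, MDifferentiableAt (𝓡 2) 𝓘(ℝ, ℝ) u (τ x) →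
      mfderiv (𝓡 2) (𝓡 2) τ x (surfaceGradient (u ∘ τ) x) = surfaceGradient u (τ x) := by
    intro u hu
    refine (surfaceGradient_unique fun w => ?_).symm
    obtain ⟨w, rfl⟩ := hsurj w
    rw [hiso, inner_surfaceGradient, mfderiv_comp x hu hτ]
    rfl
  rw [← key hu, ← key hv, hiso]

end Isometric

/-! ### Orientation double covers -/

/-! ### Maps with norm-preserving derivative do not increase distances -/

section EDistIsometric

open scoped ENNReal

theorem enorm_eq_of_inner_self_eq {V W : Type*} [NormedAddCommGroup V] [InnerProductSpace ℝ V]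
    [NormedAddCommGroup W] [InnerProductSpace ℝ W] {v : V} {w : W}
    (h : (inner ℝ v v : ℝ) = inner ℝ w w) : ‖v‖ₑ = ‖w‖ₑ := by
  rw [← ofReal_norm, ← ofReal_norm, norm_eq_sqrt_real_inner, norm_eq_sqrt_real_inner, h]

variable {X Y : Type*} [EMetricSpace X] [ChartedSpace Plane X]
  [RiemannianBundle (fun x : X => TangentSpace (𝓡 2) x)] [IsRiemannianManifold (𝓡 2) X]
  [EMetricSpace Y] [ChartedSpace Plane Y]
  [RiemannianBundle (fun x : Y => TangentSpace (𝓡 2) x)] [IsRiemannianManifold (𝓡 2) Y]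

theorem edist_map_le_of_inner_mfderiv {f : X → Y} (hf : ContMDiff (𝓡 2) (𝓡 2) ∞ f)
    (hiso : ∀ (x : X) (v w : TangentSpace (𝓡 2) x),
      inner ℝ (mfderiv (𝓡 2) (𝓡 2) f x v) (mfderiv (𝓡 2) (𝓡 2) f x w) = (inner ℝ v w : ℝ))
    (x y : X) : edist (f x) (f y) ≤ edist x y := by
  rcases eq_top_or_lt_top (edist x y) with h | h
  · rw [h]
    exact le_top
  · simpa using edist_map_le_of_enorm_mfderiv_le (I := 𝓡 2) (I' := 𝓡 2) isOpen_univ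
      (hf.of_le (by simp)).contMDiffOn (C := 1)
      (fun z _ v => by
        rw [ENNReal.coe_one, one_mul]
        exact (enorm_eq_of_inner_self_eq (hiso z v v)).le) (r := ⊤)
      (fun _ _ => mem_univ _) h

omit [IsRiemannianManifold (𝓡 2) X] in
-- Compares norms in the fibres over two points that are only propositionally equal, such as `p
-- (Φ.invFun z)` and `z`.
theorem enorm_tangentSpace_congr {a b : X} (h : a = b) {v : TangentSpace (𝓡 2) a}
    {w : TangentSpace (𝓡 2) b} (hvw : (v : Plane) = w) : ‖v‖ₑ = ‖w‖ₑ := by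
  subst h
  exact congrArg _ hvw

end EDistIsometric

namespace IsOrientationDoubleCover

/-! ### The involution is smooth and isometric -/

section Basic

variable {M N : Type*}
  [TopologicalSpace M] [ChartedSpace Plane M] [IsManifold (𝓡 2) ∞ M]
  [RiemannianBundle (fun x : M => TangentSpace (𝓡 2) x)]
  [TopologicalSpace N] [ChartedSpace Plane N] [IsManifold (𝓡 2) ∞ N]
  [RiemannianBundle (fun x : N => TangentSpace (𝓡 2) x)]
  {p : N → M} {τ : N → N} {o : OrientationField N} (h : IsOrientationDoubleCover p τ o)

include h

omit [IsManifold (𝓡 2) ∞ M] in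
theorem map_swap (x : N) : p (τ x) = p x := (h.fibre x (τ x)).2 (Or.inr rfl)

omit [IsManifold (𝓡 2) ∞ M] in
theorem comp_swap : p ∘ τ = p := funext h.map_swap

omit [IsManifold (𝓡 2) ∞ M] in
theorem swap_swap (x : N) : τ (τ x) = x :=
  ((h.fibre x (τ (τ x))).1 (by rw [h.map_swap, h.map_swap])).resolve_right (h.swap_ne (τ x))

omit [IsManifold (𝓡 2) ∞ M] in
theorem contMDiff_map : ContMDiff (𝓡 2) (𝓡 2) ∞ p := h.isLocalDiffeomorph.contMDiff

omit [IsManifold (𝓡 2) ∞ M] in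
-- Near `x` the involution is `p` followed by the local inverse of `p` around `τ x`; the assumed
-- continuity of `τ` ensures that this is the right branch.
theorem contMDiff_swap : ContMDiff (𝓡 2) (𝓡 2) ∞ τ := by
  intro x
  obtain ⟨Φ, hx, hΦ⟩ := h.isLocalDiffeomorph (τ x)
  have hpx : p x ∈ Φ.target := by
    rw [← h.map_swap, hΦ hx]
    exact Φ.map_source' hx
  have h1 : ContMDiffAt (𝓡 2) (𝓡 2) ∞ (Φ.invFun ∘ p) x :=
    (Φ.contMDiffOn_invFun.contMDiffAt (Φ.open_target.mem_nhds hpx)).comp x (h.contMDiff_map x)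
  refine h1.congr_of_eventuallyEq ?_
  filter_upwards [h.continuous_swap.continuousAt.preimage_mem_nhds (Φ.open_source.mem_nhds hx)]
    with z hz
  have h2 : Φ.invFun (Φ.toFun (τ z)) = τ z := Φ.left_inv' hz
  have h3 : p (τ z) = Φ.toFun (τ z) := hΦ hz
  rw [Function.comp_apply, ← h.map_swap, h3, h2]

omit [IsManifold (𝓡 2) ∞ M] in
theorem inner_mfderiv_swap (x : N) (v w : TangentSpace (𝓡 2) x) :
    (inner ℝ (mfderiv (𝓡 2) (𝓡 2) τ x v) (mfderiv (𝓡 2) (𝓡 2) τ x w) : ℝ) = inner ℝ v w := by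
  -- The tangent space at `q x` depends on `q`, so `p ∘ τ = p` is substituted for a variable map
  -- instead of being rewritten.
  have key : ∀ q : N → M, q = p → (inner ℝ (mfderiv (𝓡 2) (𝓡 2) q x v)
      (mfderiv (𝓡 2) (𝓡 2) q x w) : ℝ) = inner ℝ v w := by
    rintro q rfl
    exact h.inner_mfderiv x v w
  rw [← h.inner_mfderiv (τ x), ← key _ h.comp_swap,
    mfderiv_comp x ((h.contMDiff_map (τ x)).mdifferentiableAt (by simp))
      ((h.contMDiff_swap x).mdifferentiableAt (by simp))]
  rfl

end Basic

/-! ### Distances under the involution and the covering map -/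

section Metric

variable {M N : Type*}
  [EMetricSpace M] [ChartedSpace Plane M] [IsManifold (𝓡 2) ∞ M]
  [RiemannianBundle (fun x : M => TangentSpace (𝓡 2) x)] [IsRiemannianManifold (𝓡 2) M]
  [EMetricSpace N] [ChartedSpace Plane N] [IsManifold (𝓡 2) ∞ N]
  [RiemannianBundle (fun x : N => TangentSpace (𝓡 2) x)] [IsRiemannianManifold (𝓡 2) N]
  {p : N → M} {τ : N → N} {o : OrientationField N} (h : IsOrientationDoubleCover p τ o)

include h

omit [IsRiemannianManifold (𝓡 2) M] in
omit [IsManifold (𝓡 2) ∞ M] in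
theorem edist_swap (x y : N) : edist (τ x) (τ y) = edist x y := by
  refine le_antisymm (edist_map_le_of_inner_mfderiv h.contMDiff_swap h.inner_mfderiv_swap x y) ?_
  simpa only [h.swap_swap] using
    edist_map_le_of_inner_mfderiv h.contMDiff_swap h.inner_mfderiv_swap (τ x) (τ y)

/-- The involution as an isometry. -/
def swapIsometry : N ≃ᵢ N :=
  IsometryEquiv.mk' τ τ h.swap_swap h.edist_swap

omit [IsManifold (𝓡 2) ∞ M] in
/-- The covering map preserves small distances. -/
theorem eventually_edist_map_eq (x : N) : ∀ᶠ y in 𝓝 x, edist (p x) (p y) = edist x y := by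
  obtain ⟨Φ, hx, hΦ⟩ := h.isLocalDiffeomorph x
  have hpΦ : ∀ z ∈ Φ.source, p z = Φ.toFun z := fun z hz => hΦ hz
  have hinv : ∀ z ∈ Φ.source, Φ.invFun (p z) = z := fun z hz => by
    rw [hpΦ z hz]
    exact Φ.left_inv' hz
  have hright : ∀ z ∈ Φ.target, p (Φ.invFun z) = z := fun z hz => by
    rw [hpΦ _ (Φ.map_target' hz)]
    exact Φ.right_inv' hz
  have hpx : p x ∈ Φ.target := by
    rw [hpΦ x hx]
    exact Φ.map_source' hx
  obtain ⟨r, hr0, hr⟩ := EMetric.mem_nhds_iff.1 (Φ.open_target.mem_nhds hpx)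
  -- The local inverse also preserves norms, by differentiating `p ∘ Φ.invFun = id`; it gives the
  -- inequality opposite to the one from `p`, for distances below `r`.
  have hC : ∀ z ∈ Φ.target, ∀ v : TangentSpace (𝓡 2) z,
      ‖mfderiv (𝓡 2) (𝓡 2) Φ.invFun z v‖ₑ ≤ (1 : NNReal) * ‖v‖ₑ := by
    intro z hz v
    rw [ENNReal.coe_one, one_mul,
      ← enorm_eq_of_inner_self_eq (h.inner_mfderiv (Φ.invFun z) (mfderiv (𝓡 2) (𝓡 2) Φ.invFun z v) _)]
    refine (enorm_tangentSpace_congr (hright z hz) ?_).le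
    have h1 := mfderiv_comp z ((h.contMDiff_map (Φ.invFun z)).mdifferentiableAt (by simp))
      ((Φ.contMDiffOn_invFun.contMDiffAt (Φ.open_target.mem_nhds hz)).mdifferentiableAt (by simp))
    have h2 : p ∘ Φ.invFun =ᶠ[𝓝 z] id := by
      filter_upwards [Φ.open_target.mem_nhds hz] with w hw using hright w hw
    have h3 := h2.mfderiv_eq (I := 𝓡 2) (I' := 𝓡 2)
    rw [mfderiv_id] at h3
    exact (congrArg (fun L => L v) (h1.symm.trans h3) :)
  filter_upwards [Φ.open_source.mem_nhds hx,
    h.contMDiff_map.continuous.continuousAt.preimage_mem_nhds (Metric.eball_mem_nhds (p x) hr0)]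
    with y hy hyr
  refine le_antisymm (edist_map_le_of_inner_mfderiv h.contMDiff_map h.inner_mfderiv x y) ?_
  have := edist_map_le_of_enorm_mfderiv_le (I := 𝓡 2) (I' := 𝓡 2) (f := Φ.invFun) Φ.open_target
    (Φ.contMDiffOn_invFun.of_le (by simp)) hC (x := p x) (y := p y) (r := r)
    (fun z hz => hr (Metric.mem_eball'.2 hz)) (Metric.mem_eball'.1 hyr)
  rwa [hinv x hx, hinv y hy, ENNReal.coe_one, one_mul] at this

end Metric

end IsOrientationDoubleCover

/-! ### Connectedness of the orientation double cover -/

section PullbackOrientation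

theorem Orientation.map_trans {U V W : Type*} [AddCommGroup U] [Module ℝ U] [AddCommGroup V]
    [Module ℝ V] [AddCommGroup W] [Module ℝ W] (e : U ≃ₗ[ℝ] V) (f : V ≃ₗ[ℝ] W)
    (ξ : Orientation ℝ U (Fin 2)) :
    Orientation.map (Fin 2) f (Orientation.map (Fin 2) e ξ) =
      Orientation.map (Fin 2) (e.trans f) ξ := by
  induction ξ using Module.Ray.ind with
  | h v hv => rfl

/-- Reads a pulled-back orientation in trivializations: the pull-back along `e` becomes that along
the coordinate expression of `e`. -/
theorem Orientation.map_map_symm {U V W : Type*} [AddCommGroup U] [Module ℝ U] [AddCommGroup V]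
    [Module ℝ V] [AddCommGroup W] [Module ℝ W] (a : U ≃ₗ[ℝ] W) (e : U ≃ₗ[ℝ] V) (t : V ≃ₗ[ℝ] W)
    (ξ : Orientation ℝ V (Fin 2)) :
    Orientation.map (Fin 2) a (Orientation.map (Fin 2) e.symm ξ) =
      Orientation.map (Fin 2) (a.symm.trans (e.trans t)).symm (Orientation.map (Fin 2) t ξ) := by
  rw [Orientation.map_trans, Orientation.map_trans]
  congr 2
  ext v
  simp

/-- The composite of one map with the inverse of the other has positive determinant, hence fixes
orientations. -/
theorem Orientation.map_symm_eq_map_symm {P : Type*} [AddCommGroup P] [Module ℝ P]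
    [FiniteDimensional ℝ P] (hP : Module.finrank ℝ P = 2) (f g : P ≃ₗ[ℝ] P)
    (hdet : 0 < LinearMap.det (f : P →ₗ[ℝ] P) * LinearMap.det (g : P →ₗ[ℝ] P))
    (ξ : Orientation ℝ P (Fin 2)) :
    Orientation.map (Fin 2) f.symm ξ = Orientation.map (Fin 2) g.symm ξ := by
  refine (Orientation.map (Fin 2) g).injective ?_
  rw [Orientation.map_trans, Orientation.map_trans, LinearEquiv.symm_trans_self,
    Orientation.map_refl, Equiv.refl_apply,
    Orientation.map_eq_iff_det_pos ξ _ (by rw [hP, Fintype.card_fin])]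
  have h2 : ((f.symm.trans g : P ≃ₗ[ℝ] P) : P →ₗ[ℝ] P)
      = (g : P →ₗ[ℝ] P) ∘ₗ (f.symm : P →ₗ[ℝ] P) := rfl
  rw [h2, LinearMap.det_comp, LinearEquiv.det_coe_symm, ← div_eq_mul_inv]
  rw [mul_comm] at hdet
  exact div_pos_iff.2 (mul_pos_iff.1 hdet)

variable {M N : Type*}
  [TopologicalSpace M] [ChartedSpace Plane M] [IsManifold (𝓡 2) ∞ M]
  [TopologicalSpace N] [ChartedSpace Plane N] [IsManifold (𝓡 2) ∞ N]

/-- Orientations can be pulled back along immersions of surfaces. -/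
theorem OrientationField.IsContinuous.isOrientableSurface {o : OrientationField N}
    (ho : o.IsContinuous) {s : M → N} (hs : ContMDiff (𝓡 2) (𝓡 2) ∞ s)
    (hds : ∀ x, Function.Injective (mfderiv (𝓡 2) (𝓡 2) s x)) : IsOrientableSurface M := by
  have hfin : FiniteDimensional ℝ Plane := inferInstance
  have hE : ∀ x, ∃ E : TangentSpace (𝓡 2) x ≃ₗ[ℝ] TangentSpace (𝓡 2) (s x),
      ∀ v, E v = mfderiv (𝓡 2) (𝓡 2) s x v := fun x => by
    have : FiniteDimensional ℝ (TangentSpace (𝓡 2) x) := hfin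
    have : FiniteDimensional ℝ (TangentSpace (𝓡 2) (s x)) := hfin
    exact ⟨LinearEquiv.ofInjectiveOfFinrankEq (mfderiv (𝓡 2) (𝓡 2) s x).toLinearMap (hds x) rfl,
      fun v => rfl⟩
  choose E hE using hE
  refine ⟨fun x => Orientation.map (Fin 2) (E x).symm (o (s x)), fun x₀ => ?_⟩
  obtain ⟨O, hO⟩ := ho (s x₀)
  set eM := trivializationAt Plane (TangentSpace (𝓡 2) (M := M)) x₀
  set eN := trivializationAt Plane (TangentSpace (𝓡 2) (M := N)) (s x₀)
  -- The derivative of `s` in coordinates. It is continuous and invertible at `x₀`, so the sign of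
  -- its determinant is constant near `x₀`, which is all that the orientation sees.
  let A : M → Plane →L[ℝ] Plane :=
    inTangentCoordinates (𝓡 2) (𝓡 2) id s (mfderiv (𝓡 2) (𝓡 2) s) x₀
  have hA : ContinuousAt A x₀ :=
    ((hs x₀).mfderiv_const (m := 0) (by simp)).continuousAt
  have hdet : ContinuousAt (fun x => (A x).det) x₀ :=
    (ContinuousLinearMap.continuous_det.continuousAt).comp hA
  let L : ∀ x, x ∈ eM.baseSet → s x ∈ eN.baseSet → (Plane ≃ₗ[ℝ] Plane) := fun x hx hsx =>
    (eM.continuousLinearEquivAt ℝ x hx).toLinearEquiv.symm.trans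
      ((E x).trans (eN.continuousLinearEquivAt ℝ (s x) hsx).toLinearEquiv)
  have hL : ∀ x hx hsx, (L x hx hsx : Plane →ₗ[ℝ] Plane) = (A x : Plane →ₗ[ℝ] Plane) := by
    intro x hx hsx
    have h1 : A x = _ := ContinuousLinearMap.inCoordinates_eq (ϕ := mfderiv (𝓡 2) (𝓡 2) s x) hx hsx
    rw [h1]
    ext1 v
    change eN.continuousLinearEquivAt ℝ (s x) hsx (E x ((eM.continuousLinearEquivAt ℝ x hx).symm v)) = _
    rw [hE]
    rfl
  have hx₀ : x₀ ∈ eM.baseSet := FiberBundle.mem_baseSet_trivializationAt' x₀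
  have hsx₀ : s x₀ ∈ eN.baseSet := FiberBundle.mem_baseSet_trivializationAt' (s x₀)
  refine ⟨Orientation.map (Fin 2) (L x₀ hx₀ hsx₀).symm O, ?_⟩
  have hdet₀ : (A x₀).det ≠ 0 := by
    have := (L x₀ hx₀ hsx₀).isUnit_det'.ne_zero
    rwa [hL] at this
  have hsign : ∀ᶠ x in 𝓝 x₀, 0 < (A x).det * (A x₀).det :=
    (hdet.mul continuousAt_const).eventually_const_lt (mul_self_pos.2 hdet₀)
  filter_upwards [hsign, hs.continuous.continuousAt.eventually hO,
    hs.continuous.continuousAt.preimage_mem_nhds (eN.open_baseSet.mem_nhds hsx₀)] with x hx1 hx2 hx3 hx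
  have h1 := Orientation.map_map_symm (eM.continuousLinearEquivAt ℝ x hx).toLinearEquiv (E x)
    (eN.continuousLinearEquivAt ℝ (s x) hx3).toLinearEquiv (o (s x))
  refine h1.trans ?_
  rw [hx2 hx3]
  refine Orientation.map_symm_eq_map_symm (by simp) (L x hx hx3) (L x₀ hx₀ hsx₀) ?_ O
  rw [hL, hL]
  exact hx1

end PullbackOrientation

namespace IsOrientationDoubleCover

variable {M N : Type*}
  [TopologicalSpace M] [ChartedSpace Plane M] [IsManifold (𝓡 2) ∞ M]
  [RiemannianBundle (fun x : M => TangentSpace (𝓡 2) x)]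
  [TopologicalSpace N] [ChartedSpace Plane N] [IsManifold (𝓡 2) ∞ N]
  [RiemannianBundle (fun x : N => TangentSpace (𝓡 2) x)]
  {p : N → M} {τ : N → N} {o : OrientationField N} (h : IsOrientationDoubleCover p τ o)

include h

omit [IsManifold (𝓡 2) ∞ M] in
-- An invariant set is a union of fibres, and `p` is open, so `p '' W` and its complement are both
-- open in the connected `M`.
theorem eq_empty_or_univ_of_swap_mem [PreconnectedSpace M] {W : Set N} (hW : IsClopen W)
    (hτ : ∀ x ∈ W, τ x ∈ W) : W = ∅ ∨ W = univ := by
  have hsat : ∀ x ∈ W, ∀ y, p y = p x → y ∈ W := fun x hx y hy => by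
    rcases (h.fibre x y).1 hy with rfl | rfl
    exacts [hx, hτ x hx]
  have hcompl : (p '' W)ᶜ = p '' Wᶜ := by
    ext m
    constructor
    · intro hm
      obtain ⟨x, rfl⟩ := h.surjective m
      exact ⟨x, fun hx => hm ⟨x, hx, rfl⟩, rfl⟩
    · rintro ⟨y, hy, rfl⟩ ⟨x, hx, hxy⟩
      exact hy (hsat x hx y hxy.symm)
  have hopen := h.isCoveringMap.isOpenMap
  have hclopen : IsClopen (p '' W) :=
    ⟨⟨hcompl ▸ hopen _ hW.compl.isOpen⟩, hopen _ hW.isOpen⟩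
  rcases isClopen_iff.1 hclopen with h1 | h1
  · exact Or.inl (image_eq_empty.1 h1)
  · refine Or.inr (eq_univ_of_forall fun y => ?_)
    obtain ⟨x, hx, hxy⟩ : p y ∈ p '' W := h1 ▸ mem_univ _
    exact hsat x hx y hxy.symm

/-- The orientation double cover of a connected non-orientable surface is connected. -/
theorem connectedSpace [ConnectedSpace M] (hM : ¬ IsOrientableSurface M) : ConnectedSpace N := by
  have hne : Nonempty N := (h.surjective (Classical.arbitrary M)).nonempty
  have hpre : PreconnectedSpace N := by
    refine preconnectedSpace_iff_clopen.2 fun U hU => ?_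
    by_contra! hcon
    have hτU : IsClopen (τ ⁻¹' U) := hU.preimage h.continuous_swap
    -- The intersection and the union of `U` with its mirror image are invariant, hence trivial; so
    -- `U` contains exactly one point of each fibre.
    have hdisj : U ∩ τ ⁻¹' U = ∅ := by
      refine (h.eq_empty_or_univ_of_swap_mem (hU.inter hτU) fun x hx => ?_).resolve_right
        fun hu => hcon.2 (univ_subset_iff.1 (hu ▸ inter_subset_left))
      exact ⟨hx.2, by simpa [h.swap_swap] using hx.1⟩
    have hcov : U ∪ τ ⁻¹' U = univ := by
      refine (h.eq_empty_or_univ_of_swap_mem (hU.union hτU) fun x hx => ?_).resolve_left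
        fun hu => hcon.1.ne_empty (subset_empty_iff.1 (hu ▸ subset_union_left))
      exact hx.elim (fun hx => Or.inr (by simpa [h.swap_swap] using hx)) Or.inl
    have huniq : ∀ x ∈ U, ∀ y ∈ U, p y = p x → y = x := fun x hx y hy hyx => by
      refine ((h.fibre x y).1 hyx).resolve_right ?_
      rintro rfl
      exact (hdisj ▸ (⟨hx, hy⟩ : x ∈ U ∩ τ ⁻¹' U) : x ∈ (∅ : Set N))
    have hex : ∀ m, ∃ x ∈ U, p x = m := fun m => by
      obtain ⟨x, rfl⟩ := h.surjective m
      rcases (hcov ▸ mem_univ x : x ∈ U ∪ τ ⁻¹' U) with hx | hx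
      exacts [⟨x, hx, rfl⟩, ⟨τ x, hx, h.map_swap x⟩]
    choose s hsU hps using hex
    -- The inverse branch of `p` through `s m` stays in the open set `U` near `m`, and `U` has one
    -- point per fibre, so the branch is `s`.
    have hs : ContMDiff (𝓡 2) (𝓡 2) ∞ s := by
      intro m
      obtain ⟨Φ, hx, hΦ⟩ := h.isLocalDiffeomorph (s m)
      have hpΦ : ∀ z ∈ Φ.source, p z = Φ.toFun z := fun z hz => hΦ hz
      have hm : m = Φ.toFun (s m) := by rw [← hpΦ _ hx, hps]
      have hmt : m ∈ Φ.target := hm ▸ Φ.map_source' hx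
      have hms : Φ.invFun m = s m := (congrArg Φ.invFun hm).trans (Φ.left_inv' hx)
      have hΦm := Φ.contMDiffOn_invFun.contMDiffAt (Φ.open_target.mem_nhds hmt)
      refine hΦm.congr_of_eventuallyEq ?_
      filter_upwards [Φ.open_target.mem_nhds hmt, hΦm.continuousAt.preimage_mem_nhds
        (hU.isOpen.mem_nhds (hms ▸ hsU m))] with z hz hzU
      refine huniq _ hzU _ (hsU z) ?_
      rw [hps, hpΦ _ (Φ.map_target' hz)]
      exact (Φ.right_inv' hz).symm
    refine hM (h.orientation_continuous.isOrientableSurface hs fun m => ?_)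
    have key : ∀ q : M → M, q = id → Function.Injective (mfderiv (𝓡 2) (𝓡 2) q m) := by
      rintro q rfl
      rw [mfderiv_id]
      exact Function.injective_id
    have h1 := key (p ∘ s) (funext hps)
    rw [mfderiv_comp m ((h.contMDiff_map (s m)).mdifferentiableAt (by simp))
      ((hs m).mdifferentiableAt (by simp))] at h1
    exact Function.Injective.of_comp h1
  exact ⟨hne⟩

end IsOrientationDoubleCover

/-! ### A rigidity theorem for harmonic functions -/

section Rigidity

/-- A smooth increasing function whose derivative is supported in a given interval. -/
theorem exists_contDiff_deriv_pos_iff (c : ℝ) {ε : ℝ} (hε : 0 < ε) :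
    ∃ F : ℝ → ℝ, ContDiff ℝ ∞ F ∧ (∀ t, 0 ≤ deriv F t) ∧ (∀ t, ε ≤ |t - c| → deriv F t = 0) ∧
      ∀ t, |t - c| < ε → 0 < deriv F t := by
  let f : ContDiffBump c := ⟨ε / 2, ε, half_pos hε, half_lt_self hε⟩
  have hf : Continuous f := f.continuous
  have hd : ∀ t, HasDerivAt (fun t => ∫ r in (0 : ℝ)..t, f r) (f t) t := fun t =>
    intervalIntegral.integral_hasDerivAt_right (hf.intervalIntegrable _ _)
      (hf.stronglyMeasurableAtFilter _ _) hf.continuousAt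
  have hderiv : deriv (fun t => ∫ r in (0 : ℝ)..t, f r) = f := funext fun t => (hd t).deriv
  refine ⟨fun t => ∫ r in (0 : ℝ)..t, f r, ?_, ?_, ?_, ?_⟩
  · rw [contDiff_infty_iff_deriv, hderiv]
    exact ⟨fun t => (hd t).differentiableAt, f.contDiff⟩
  · rw [hderiv]
    exact fun t => f.nonneg
  · rw [hderiv]
    exact fun t ht => f.zero_of_le_dist ht
  · rw [hderiv]
    exact fun t ht => f.pos_of_mem_ball ht

variable {N : Type*} [EMetricSpace N] [MeasurableSpace N] [BorelSpace N]
  [ChartedSpace Plane N] [IsManifold (𝓡 2) ∞ N]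
  [RiemannianBundle (fun x : N => TangentSpace (𝓡 2) x)]
  [IsContMDiffRiemannianBundle (𝓡 2) ∞ Plane (fun x : N => TangentSpace (𝓡 2) x)]
  [IsRiemannianManifold (𝓡 2) N]

/-- A weakly harmonic function, continuous and smooth off one point, is locally constant where its
value is not one of finitely many boundary values. -/
theorem eventually_eq_of_weakly_harmonic {u : N → ℝ} (y : N) (hc : Continuous u)
    (hsm : ContMDiffOn (𝓡 2) 𝓘(ℝ, ℝ) ∞ u {y}ᶜ)
    (hint : LocallyIntegrable (fun x => ‖surfaceGradient u x‖) (surfaceArea N))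
    (hw : ∀ φ : N → ℝ, ContMDiff (𝓡 2) 𝓘(ℝ, ℝ) ∞ φ →
      (∃ K : Set N, IsCompact K ∧ ∀ x ∉ K, mfderiv (𝓡 2) 𝓘(ℝ, ℝ) φ x = 0) →
      ∫ x, inner ℝ (surfaceGradient u x) (surfaceGradient φ x) ∂(surfaceArea N) = 0)
    {S : Set ℝ} (hS : IsClosed S) (hyS : u y ∈ S) (hlim : Tendsto u (cocompact N) (𝓝ˢ S))
    {x₀ : N} (hx₀ : u x₀ ∉ S) : ∀ᶠ z in 𝓝 x₀, u z = u x₀ := by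
  have := nullSingletonClass_surfaceArea (N := N)
  have := isOpenPosMeasure_surfaceArea (N := N)
  obtain ⟨δ, hδ, hδS⟩ := Metric.isOpen_iff.1 hS.isOpen_compl (u x₀) hx₀
  -- The `δ`-ball around `u x₀` misses `S`; with `F'` supported in radius `δ / 2`, `F` is locally
  -- constant near every value in `S`.
  obtain ⟨F, hF, hF0, hFz, hFp⟩ := exists_contDiff_deriv_pos_iff (u x₀) (half_pos hδ)
  have hfar : {t : ℝ | δ / 2 < |t - u x₀|} ∈ 𝓝ˢ S := by
    refine IsOpen.mem_nhdsSet (isOpen_lt (by fun_prop) (by fun_prop)) |>.2 fun t ht => ?_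
    by_contra hlt
    rw [mem_ofPred_eq, not_lt] at hlt
    exact hδS (show t ∈ Metric.ball (u x₀) δ from (hlt.trans_lt (half_lt_self hδ) : _)) ht
  have hFd : Differentiable ℝ F := hF.differentiable (by simp)
  have hnear : ∀ t, δ / 2 < |t - u x₀| → ∀ᶠ r in 𝓝 t, F r = F t := fun t ht => by
    refine eventually_eq_of_mfderiv_eq_zero (I := 𝓘(ℝ, ℝ)) ?_
    have : ∀ᶠ r in 𝓝 t, δ / 2 < |r - u x₀| :=
      (isOpen_lt (by fun_prop) (by fun_prop)).mem_nhds ht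
    filter_upwards [this] with r hr
    refine ⟨(hF.of_le (by simp)).contMDiff r, ?_⟩
    rw [mfderiv_eq_fderiv]
    have h1 : fderiv ℝ F r = 0 := by
      ext
      simpa using hFz r hr.le
    exact h1
  have huy : δ / 2 < |u y - u x₀| := subset_of_mem_nhdsSet hfar hyS
  have hdiff : ∀ z ≠ y, MDifferentiableAt (𝓡 2) 𝓘(ℝ, ℝ) u z := fun z hz =>
    (hsm.contMDiffAt (isOpen_compl_singleton.mem_nhds hz)).mdifferentiableAt (by simp)
  have hconst : ∀ z, δ / 2 < |u z - u x₀| → (fun w => F (u w)) =ᶠ[𝓝 z] fun _ => F (u z) :=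
    fun z hz => hc.continuousAt.eventually (hnear _ hz)
  -- At `y` smoothness holds because `F ∘ u` is constant there: `u y ∈ S`.
  have hφ : ContMDiff (𝓡 2) 𝓘(ℝ, ℝ) ∞ (fun z => F (u z)) := by
    intro z
    by_cases hz : z = y
    · subst hz
      exact contMDiffAt_const.congr_of_eventuallyEq (hconst z huy)
    · exact (hF.contMDiff (u z)).comp z (hsm.contMDiffAt (isOpen_compl_singleton.mem_nhds hz))
  obtain ⟨K, hK, hKu⟩ := mem_cocompact.1 (hlim hfar)
  have hφK : ∀ x ∉ K, mfderiv (𝓡 2) 𝓘(ℝ, ℝ) (fun z => F (u z)) x = 0 := fun x hx => by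
    rw [(hconst x (hKu hx)).mfderiv_eq]
    exact mfderiv_const
  have hgrad : ∀ z ≠ y, (inner ℝ (surfaceGradient u z) (surfaceGradient (fun z => F (u z)) z) : ℝ)
      = deriv F (u z) * ‖surfaceGradient u z‖ ^ 2 := fun z hz => by
    rw [surfaceGradient_comp (hFd _) (hdiff z hz), real_inner_smul_right, real_inner_self_eq_norm_sq]
  have hzero := hw _ hφ ⟨K, hK, hφK⟩
  have hae : ∀ᵐ z ∂(surfaceArea N), z ≠ y := compl_mem_ae_iff.2 (measure_singleton y)
  rw [integral_eq_zero_iff_of_nonneg_ae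
    (by filter_upwards [hae] with z hz
        rw [hgrad z hz]
        exact mul_nonneg (hF0 _) (sq_nonneg _))
    (integrable_inner_surfaceGradient (finite_singleton y) hsm hint hφ hK hφK)] at hzero
  -- The nonnegative integrand `F'(u) |∇u|²` has zero integral, and it is continuous off `y`, so it
  -- vanishes there identically.
  have hall := Measure.eqOn_open_of_ae_eq (ae_restrict_of_ae hzero) isOpen_compl_singleton
    (continuousOn_inner_surfaceGradient isOpen_compl_singleton hsm hφ.contMDiffOn) continuousOn_const
  refine eventually_eq_of_mfderiv_eq_zero (I := 𝓡 2) ?_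
  have hx₀y : x₀ ≠ y := by
    rintro rfl
    exact hx₀ hyS
  have hclose : ∀ᶠ z in 𝓝 x₀, |u z - u x₀| < δ / 2 :=
    (isOpen_lt (by fun_prop) (by fun_prop)).mem_nhds (by simpa using half_pos hδ)
  filter_upwards [hclose, isOpen_compl_singleton.mem_nhds hx₀y] with z hz hzy
  refine ⟨(hsm.contMDiffAt (isOpen_compl_singleton.mem_nhds hzy)).of_le (by simp), ?_⟩
  have h1 := (hgrad z hzy).symm.trans (hall hzy)
  have h2 := (mul_eq_zero.1 h1).resolve_left (hFp _ hz).ne'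
  exact surfaceGradient_eq_zero_iff.1 (norm_eq_zero.1 (pow_eq_zero_iff two_ne_zero |>.1 h2))

/-- A weakly harmonic function without flux through the ends, which tends to finitely many values
at infinity, is constant. -/
theorem exists_eq_const_of_weakly_harmonic [PreconnectedSpace N] {u : N → ℝ} (y : N)
    (hc : Continuous u) (hsm : ContMDiffOn (𝓡 2) 𝓘(ℝ, ℝ) ∞ u {y}ᶜ)
    (hint : LocallyIntegrable (fun x => ‖surfaceGradient u x‖) (surfaceArea N))
    (hw : ∀ φ : N → ℝ, ContMDiff (𝓡 2) 𝓘(ℝ, ℝ) ∞ φ →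
      (∃ K : Set N, IsCompact K ∧ ∀ x ∉ K, mfderiv (𝓡 2) 𝓘(ℝ, ℝ) φ x = 0) →
      ∫ x, inner ℝ (surfaceGradient u x) (surfaceGradient φ x) ∂(surfaceArea N) = 0)
    {S : Set ℝ} (hS : S.Finite) (hlim : Tendsto u (cocompact N) (𝓝ˢ S)) :
    ∀ x, u x = u y := by
  -- The value at the possibly singular point is treated like a value at infinity.
  have hS' : (insert (u y) S).Finite := hS.insert _
  by_cases hex : ∃ x₀, u x₀ ∉ insert (u y) S
  · obtain ⟨x₀, hx₀⟩ := hex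
    have hclopen : IsClopen {x | u x = u x₀} := by
      refine ⟨isClosed_eq hc continuous_const, isOpen_iff_mem_nhds.2 fun x hx => ?_⟩
      rw [mem_ofPred_eq] at hx
      have := eventually_eq_of_weakly_harmonic y hc hsm hint hw hS'.isClosed (mem_insert _ _)
        (hlim.mono_right (nhdsSet_mono (subset_insert _ _))) (x₀ := x) (hx ▸ hx₀)
      filter_upwards [this] with z hz using hz.trans hx
    have huniv := hclopen.eq_univ ⟨x₀, rfl⟩
    have hall : ∀ x, u x = u x₀ := fun x => huniv.ge (mem_univ x)
    exact fun x => (hall x).trans (hall y).symm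
  · push Not at hex
    have hpre : IsPreconnected (range u) := isPreconnected_range hc
    have hfin : (range u).Finite := hS'.subset (range_subset_iff.2 hex)
    exact fun x => hfin.countable.isTotallyDisconnected (range u) subset_rfl hpre (mem_range_self x)
      (mem_range_self y)

end Rigidity

/-! ### Differences of functions with a weak Laplacian -/

section Differences

variable {N : Type*} [EMetricSpace N] [MeasurableSpace N] [BorelSpace N]

theorem LocallyIntegrable.comp_isometryEquiv {f : N → ℝ} (hf : LocallyIntegrable f (surfaceArea N))
    (e : N ≃ᵢ N) : LocallyIntegrable (fun x => f (e x)) (surfaceArea N) := by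
  intro x
  obtain ⟨U, hU, hfU⟩ := hf (e x)
  refine ⟨e ⁻¹' U, e.continuous.continuousAt.preimage_mem_nhds hU, ?_⟩
  exact ((e.measurePreserving_euclideanHausdorffMeasure 2).integrableOn_comp_preimage
    e.toHomeomorph.measurableEmbedding).2 hfU

theorem integral_comp_isometryEquiv (f : N → ℝ) (e : N ≃ᵢ N) :
    ∫ x, f (e x) ∂(surfaceArea N) = ∫ x, f x ∂(surfaceArea N) :=
  (e.measurePreserving_euclideanHausdorffMeasure 2).integral_comp
    e.toHomeomorph.measurableEmbedding f

theorem ae_notMem_finite {s : Set N} (hs : s.Finite) : ∀ᵐ x ∂(surfaceArea N), x ∉ s := by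
  have := nullSingletonClass_surfaceArea (N := N)
  exact compl_mem_ae_iff.2 (hs.measure_zero _)

variable [ChartedSpace Plane N] [IsManifold (𝓡 2) ∞ N]
  [RiemannianBundle (fun x : N => TangentSpace (𝓡 2) x)]
  [IsContMDiffRiemannianBundle (𝓡 2) ∞ Plane (fun x : N => TangentSpace (𝓡 2) x)]

omit [RiemannianBundle (fun x : N => TangentSpace (𝓡 2) x)] [MeasurableSpace N] [BorelSpace N]
  [IsManifold (𝓡 2) ∞ N] in
theorem mdifferentiableAt_of_contMDiffOn_compl {u : N → ℝ} {s : Set N} (hs : s.Finite)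
    (hu : ContMDiffOn (𝓡 2) 𝓘(ℝ, ℝ) ∞ u sᶜ) {x : N} (hx : x ∉ s) :
    MDifferentiableAt (𝓡 2) 𝓘(ℝ, ℝ) u x :=
  (hu.contMDiffAt (hs.isClosed.isOpen_compl.mem_nhds hx)).mdifferentiableAt (by simp)

theorem locallyIntegrable_norm_surfaceGradient_sub {u v : N → ℝ} {s : Set N} (hs : s.Finite)
    (hu : ContMDiffOn (𝓡 2) 𝓘(ℝ, ℝ) ∞ u sᶜ) (hv : ContMDiffOn (𝓡 2) 𝓘(ℝ, ℝ) ∞ v sᶜ)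
    (hu' : LocallyIntegrable (fun x => ‖surfaceGradient u x‖) (surfaceArea N))
    (hv' : LocallyIntegrable (fun x => ‖surfaceGradient v x‖) (surfaceArea N)) :
    LocallyIntegrable (fun x => ‖surfaceGradient (fun z => u z - v z) x‖) (surfaceArea N) := by
  have hmeas := aestronglyMeasurable_inner_surfaceGradient hs (hu.sub hv) (hu.sub hv)
  refine (hu'.add hv').mono ?_ ?_
  · simp only [norm_eq_sqrt_real_inner]
    exact Real.continuous_sqrt.comp_aestronglyMeasurable hmeas
  · filter_upwards [ae_notMem_finite hs] with x hx
    rw [surfaceGradient_sub (mdifferentiableAt_of_contMDiffOn_compl hs hu hx)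
      (mdifferentiableAt_of_contMDiffOn_compl hs hv hx), norm_norm]
    refine (norm_sub_le _ _).trans ?_
    exact Real.le_norm_self _

theorem integral_inner_surfaceGradient_sub {u v φ : N → ℝ} {s : Set N} (hs : s.Finite)
    (hu : ContMDiffOn (𝓡 2) 𝓘(ℝ, ℝ) ∞ u sᶜ) (hv : ContMDiffOn (𝓡 2) 𝓘(ℝ, ℝ) ∞ v sᶜ)
    (hu' : LocallyIntegrable (fun x => ‖surfaceGradient u x‖) (surfaceArea N))
    (hv' : LocallyIntegrable (fun x => ‖surfaceGradient v x‖) (surfaceArea N))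
    (hφ : ContMDiff (𝓡 2) 𝓘(ℝ, ℝ) ∞ φ) {K : Set N} (hK : IsCompact K)
    (hφK : ∀ x ∉ K, mfderiv (𝓡 2) 𝓘(ℝ, ℝ) φ x = 0) :
    ∫ x, inner ℝ (surfaceGradient (fun z => u z - v z) x) (surfaceGradient φ x) ∂(surfaceArea N) =
      ∫ x, inner ℝ (surfaceGradient u x) (surfaceGradient φ x) ∂(surfaceArea N)
        - ∫ x, inner ℝ (surfaceGradient v x) (surfaceGradient φ x) ∂(surfaceArea N) := by
  rw [← integral_sub (integrable_inner_surfaceGradient hs hu hu' hφ hK hφK)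
    (integrable_inner_surfaceGradient hs hv hv' hφ hK hφK)]
  refine integral_congr_ae ?_
  filter_upwards [ae_notMem_finite hs] with x hx
  rw [surfaceGradient_sub (mdifferentiableAt_of_contMDiffOn_compl hs hu hx)
    (mdifferentiableAt_of_contMDiffOn_compl hs hv hx), inner_sub_left]

omit [IsManifold (𝓡 2) ∞ N] [MeasurableSpace N] [BorelSpace N]
  [IsContMDiffRiemannianBundle (𝓡 2) ∞ Plane (fun x : N => TangentSpace (𝓡 2) x)]
  [RiemannianBundle (fun x : N => TangentSpace (𝓡 2) x)] in
theorem mfderiv_eq_zero_of_notMem_tsupport {φ : N → ℝ} {x : N} (hx : x ∉ tsupport φ) :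
    mfderiv (𝓡 2) 𝓘(ℝ, ℝ) φ x = 0 := by
  have h1 : φ =ᶠ[𝓝 x] fun _ => 0 := notMem_tsupport_iff_eventuallyEq.1 hx
  have h2 := h1.mfderiv_eq (I := 𝓡 2) (I' := 𝓘(ℝ, ℝ))
  rw [mfderiv_const] at h2
  exact h2

end Differences

/-! ### Equivariance of the Green's function -/

namespace IsOrientationDoubleCover

variable {M N : Type*}
  [EMetricSpace M] [ChartedSpace Plane M]
  [RiemannianBundle (fun x : M => TangentSpace (𝓡 2) x)]
  [EMetricSpace N] [ChartedSpace Plane N] [IsManifold (𝓡 2) ∞ N]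
  [RiemannianBundle (fun x : N => TangentSpace (𝓡 2) x)]
  [IsContMDiffRiemannianBundle (𝓡 2) ∞ Plane (fun x : N => TangentSpace (𝓡 2) x)]
  [IsRiemannianManifold (𝓡 2) N] [MeasurableSpace N] [BorelSpace N]
  {p : N → M} {τ : N → N} {o : OrientationField N} (h : IsOrientationDoubleCover p τ o)
  {G : N → N → ℝ}

include h

omit [IsContMDiffRiemannianBundle (𝓡 2) ∞ Plane (fun x : N => TangentSpace (𝓡 2) x)]
  [IsRiemannianManifold (𝓡 2) N] in
theorem contMDiffOn_green_swap (hG : IsGreenFunction G) (y : N) :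
    ContMDiffOn (𝓡 2) 𝓘(ℝ, ℝ) ∞ (fun x => G (τ x) (τ y)) {y}ᶜ :=
  (hG.smooth (τ y)).comp h.contMDiff_swap.contMDiffOn fun x hx hxy =>
    hx (by rw [mem_singleton_iff, ← h.swap_swap x, mem_singleton_iff.1 hxy, h.swap_swap])

omit [IsContMDiffRiemannianBundle (𝓡 2) ∞ Plane (fun x : N => TangentSpace (𝓡 2) x)]
  [IsRiemannianManifold (𝓡 2) N] [MeasurableSpace N] [BorelSpace N] in
theorem inner_surfaceGradient_swap {u φ : N → ℝ} {y : N}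
    (hu : ContMDiffOn (𝓡 2) 𝓘(ℝ, ℝ) ∞ u {τ y}ᶜ) (hφ : ContMDiffOn (𝓡 2) 𝓘(ℝ, ℝ) ∞ φ {τ y}ᶜ)
    {x : N} (hx : x ≠ y) :
    (inner ℝ (surfaceGradient (fun z => u (τ z)) x) (surfaceGradient (fun z => φ (τ z)) x) : ℝ) =
      inner ℝ (surfaceGradient u (τ x)) (surfaceGradient φ (τ x)) := by
  have hτx : τ x ∉ ({τ y} : Set N) := fun hxy =>
    hx (by rw [← h.swap_swap x, mem_singleton_iff.1 hxy, h.swap_swap])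
  exact inner_surfaceGradient_comp ((h.contMDiff_swap x).mdifferentiableAt (by simp))
    (h.inner_mfderiv_swap x) (mdifferentiableAt_of_contMDiffOn_compl (finite_singleton _) hu hτx)
    (mdifferentiableAt_of_contMDiffOn_compl (finite_singleton _) hφ hτx)

theorem locallyIntegrable_norm_surfaceGradient_green_swap (hG : IsGreenFunction G) (y : N) :
    LocallyIntegrable (fun x => ‖surfaceGradient (fun z => G (τ z) (τ y)) x‖) (surfaceArea N) := by
  have h1 := LocallyIntegrable.comp_isometryEquiv (hG.laplacian (τ y)).locallyIntegrable_gradient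
    h.swapIsometry
  have hs := h.contMDiffOn_green_swap hG y
  have hmeas := aestronglyMeasurable_inner_surfaceGradient (finite_singleton y) hs hs
  refine h1.mono ?_ ?_
  · simp only [norm_eq_sqrt_real_inner]
    exact Real.continuous_sqrt.comp_aestronglyMeasurable hmeas
  · filter_upwards [ae_notMem_finite (finite_singleton y)] with x hx
    rw [norm_norm, norm_norm, norm_eq_sqrt_real_inner, norm_eq_sqrt_real_inner,
      h.inner_surfaceGradient_swap (hG.smooth (τ y)) (hG.smooth (τ y)) hx]
    rfl

omit [IsContMDiffRiemannianBundle (𝓡 2) ∞ Plane (fun x : N => TangentSpace (𝓡 2) x)] in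
-- Change of variables by the isometry `τ`, which moves `τ` from the kernel to the test function,
-- the form in which the circulation hypothesis is stated.
theorem integral_inner_surfaceGradient_green_swap (hG : IsGreenFunction G) (y : N) {φ : N → ℝ}
    (hφ : ContMDiff (𝓡 2) 𝓘(ℝ, ℝ) ∞ φ) :
    ∫ x, inner ℝ (surfaceGradient (fun z => G (τ z) (τ y)) x) (surfaceGradient φ x)
        ∂(surfaceArea N) =
      ∫ x, inner ℝ (surfaceGradient (fun z => G z (τ y)) x) (surfaceGradient (φ ∘ τ) x)
        ∂(surfaceArea N) := by
  refine Eq.trans ?_ (integral_comp_isometryEquiv _ h.swapIsometry)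
  refine integral_congr_ae ?_
  filter_upwards [ae_notMem_finite (finite_singleton y)] with x hx
  have h1 := h.inner_surfaceGradient_swap (hG.smooth (τ y))
    (hφ.comp h.contMDiff_swap).contMDiffOn hx
  have h2 : (fun z => (φ ∘ τ) (τ z)) = φ := funext fun z => by
    rw [Function.comp_apply, h.swap_swap]
  rw [h2] at h1
  exact h1

omit [IsContMDiffRiemannianBundle (𝓡 2) ∞ Plane (fun x : N => TangentSpace (𝓡 2) x)] in
/-- The flux of the gradients of `G(·, y)` and of `G(τ ·, τ y)` against test functions agree. -/
theorem integral_inner_surfaceGradient_green_swap_eq (hG : IsGreenFunction G)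
    (hends : NoncompactSpace N → HasSymmetricEnds τ G) (y : N) {φ : N → ℝ}
    (hφ : ContMDiff (𝓡 2) 𝓘(ℝ, ℝ) ∞ φ)
    (hφK : ∃ K : Set N, IsCompact K ∧ ∀ x ∉ K, mfderiv (𝓡 2) 𝓘(ℝ, ℝ) φ x = 0) :
    ∫ x, inner ℝ (surfaceGradient (fun z => G (τ z) (τ y)) x) (surfaceGradient φ x)
        ∂(surfaceArea N) =
      ∫ x, inner ℝ (surfaceGradient (fun z => G z y) x) (surfaceGradient φ x)
        ∂(surfaceArea N) := by
  rw [h.integral_inner_surfaceGradient_green_swap hG y hφ]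
  have hφτ := hφ.comp h.contMDiff_swap
  have hval : (φ ∘ τ) (τ y) = φ y := by rw [Function.comp_apply, h.swap_swap]
  -- On a closed surface the weak equations at `τ y` and `y` have the same right-hand side, since `φ
  -- ∘ τ` and `φ` have equal integrals. Otherwise the equal circulations contain the same point
  -- value `φ y`, which cancels.
  by_cases hcomp : CompactSpace N
  · have h1 := (hG.laplacian (τ y)).eq _ hφτ (HasCompactSupport.of_compactSpace _)
    have h2 := (hG.laplacian y).eq _ hφ (HasCompactSupport.of_compactSpace _)
    have h3 : ∫ x, (φ ∘ τ) x ∂(surfaceArea N) = ∫ x, φ x ∂(surfaceArea N) :=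
      integral_comp_isometryEquiv φ h.swapIsometry
    rw [hval, h3, ← h2] at h1
    exact neg_injective h1
  · have h1 := (hends (not_compactSpace_iff.1 hcomp)).circulation y φ hφ hφK
    rw [endCirculation, endCirculation, hval] at h1
    exact add_left_cancel h1

omit [IsContMDiffRiemannianBundle (𝓡 2) ∞ Plane (fun x : N => TangentSpace (𝓡 2) x)] in
-- As `τ` preserves distances, the logarithms subtracted at the two poles are equal and cancel.
theorem tendsto_green_swap_sub (hG : IsGreenFunction G) {R : N → ℝ}
    (hR : IsRobinFunction geodesicDist G R) (y : N) :
    Tendsto (fun x => G (τ x) (τ y) - G x y) (𝓝[≠] y) (𝓝 (R (τ y) - R y)) := by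
  have hτ : Tendsto τ (𝓝[≠] y) (𝓝[≠] (τ y)) :=
    h.continuous_swap.continuousAt.continuousWithinAt.tendsto_nhdsWithin fun x hx hxy =>
      hx (by rw [mem_singleton_iff, ← h.swap_swap x, mem_singleton_iff.1 hxy, h.swap_swap])
  refine (((hR (τ y)).comp hτ).sub (hR y)).congr fun x => ?_
  simp only [Function.comp_apply, geodesicDist, h.edist_swap]
  rw [hG.symm (τ y), hG.symm y]
  ring

/-- The Green's function and the Robin function are invariant under the involution up to constants
depending on the pole. -/
theorem green_swap_sub_eq [PreconnectedSpace N] (hG : IsGreenFunction G)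
    (hends : NoncompactSpace N → HasSymmetricEnds τ G) {R : N → ℝ}
    (hR : IsRobinFunction geodesicDist G R) {x y : N} (hxy : x ≠ y) :
    G (τ x) (τ y) - G x y = R (τ y) - R y := by
  classical
  set u₀ : N → ℝ := fun x => G (τ x) (τ y) - G x y with hu₀
  set u := Function.update u₀ y (R (τ y) - R y) with hu
  have huy : u y = R (τ y) - R y := Function.update_self ..
  have hne : ∀ {z}, z ≠ y → u z = u₀ z := fun hz => Function.update_of_ne hz ..
  have hnear : ∀ {z}, z ≠ y → u =ᶠ[𝓝 z] u₀ := fun hz => by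
    filter_upwards [isOpen_compl_singleton.mem_nhds hz] with w hw using hne hw
  have hsw := h.contMDiffOn_green_swap hG y
  have hsm₀ : ContMDiffOn (𝓡 2) 𝓘(ℝ, ℝ) ∞ u₀ {y}ᶜ := hsw.sub (hG.smooth y)
  have hsm : ContMDiffOn (𝓡 2) 𝓘(ℝ, ℝ) ∞ u {y}ᶜ := hsm₀.congr fun z hz => hne hz
  have hc : Continuous u := by
    refine continuous_iff_continuousAt.2 fun z => ?_
    by_cases hz : z = y
    · subst hz
      exact continuousAt_update_same.2 (h.tendsto_green_swap_sub hG hR z)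
    · exact hsm.continuousOn.continuousAt (isOpen_compl_singleton.mem_nhds hz)
  have hae : ∀ᵐ z ∂(surfaceArea N), surfaceGradient u z = surfaceGradient u₀ z := by
    filter_upwards [ae_notMem_finite (finite_singleton y)] with z hz
    exact surfaceGradient_congr (hnear hz)
  have hswint := h.locallyIntegrable_norm_surfaceGradient_green_swap hG y
  have hGint := (hG.laplacian y).locallyIntegrable_gradient
  have hint : LocallyIntegrable (fun x => ‖surfaceGradient u x‖) (surfaceArea N) := by
    refine (locallyIntegrable_norm_surfaceGradient_sub (finite_singleton y) hsw (hG.smooth y)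
      hswint hGint).congr ?_
    filter_upwards [hae] with z hz
    rw [hz]
  have hw : ∀ φ : N → ℝ, ContMDiff (𝓡 2) 𝓘(ℝ, ℝ) ∞ φ →
      (∃ K : Set N, IsCompact K ∧ ∀ x ∉ K, mfderiv (𝓡 2) 𝓘(ℝ, ℝ) φ x = 0) →
      ∫ x, inner ℝ (surfaceGradient u x) (surfaceGradient φ x) ∂(surfaceArea N) = 0 := by
    intro φ hφ hφK
    have h1 := h.integral_inner_surfaceGradient_green_swap_eq hG hends y hφ hφK
    obtain ⟨K, hK, hφK⟩ := hφK
    rw [← sub_eq_zero, ← integral_inner_surfaceGradient_sub (finite_singleton y) hsw (hG.smooth y)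
      hswint hGint hφ hK hφK] at h1
    rw [← h1]
    refine integral_congr_ae ?_
    filter_upwards [hae] with z hz
    rw [hz]
  obtain ⟨S, hS, hlim⟩ : ∃ S : Set ℝ, S.Finite ∧ Tendsto u (cocompact N) (𝓝ˢ S) := by
    by_cases hcomp : CompactSpace N
    -- On a closed surface `cocompact N` is the trivial filter.
    · exact ⟨∅, finite_empty, by simp⟩
    · obtain ⟨S, hS, hlim⟩ := (hends (not_compactSpace_iff.1 hcomp)).streamline y
      refine ⟨S, hS, hlim.congr' ?_⟩
      filter_upwards [(isCompact_singleton (x := y)).compl_mem_cocompact] with z hz using (hne hz).symm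
  have := exists_eq_const_of_weakly_harmonic y hc hsm hint hw hS hlim x
  rwa [huy, hne hxy] at this

/-- Evaluating the constant difference at `x = τ y` gives `G y (τ y) - G (τ y) y`, which vanishes by
symmetry. -/
theorem robin_swap [PreconnectedSpace N] (hG : IsGreenFunction G)
    (hends : NoncompactSpace N → HasSymmetricEnds τ G) {R : N → ℝ}
    (hR : IsRobinFunction geodesicDist G R) (y : N) : R (τ y) = R y := by
  have h1 := h.green_swap_sub_eq hG hends hR (h.swap_ne y)
  rw [h.swap_swap, hG.symm, sub_self] at h1
  exact (sub_eq_zero.1 h1.symm)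

theorem green_swap [PreconnectedSpace N] (hG : IsGreenFunction G)
    (hends : NoncompactSpace N → HasSymmetricEnds τ G) {R : N → ℝ}
    (hR : IsRobinFunction geodesicDist G R) {x y : N} (hxy : x ≠ y) : G (τ x) (τ y) = G x y := by
  have h1 := h.green_swap_sub_eq hG hends hR hxy
  rw [h.robin_swap hG hends hR, sub_self] at h1
  exact sub_eq_zero.1 h1

end IsOrientationDoubleCover

/-! ### The Hamiltonian -/

section Hamiltonian

/-- Every index of the first half precedes every index of the second, so all `n²` mixed pairs occur,
including each vortex with its own image. -/
theorem sum_Ioi_append {n : ℕ} (f : Fin (n + n) → Fin (n + n) → ℝ) :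
    ∑ i, ∑ j ∈ Finset.Ioi i, f i j =
      (∑ i : Fin n, ∑ j ∈ Finset.Ioi i, f (i.castAdd n) (j.castAdd n)) +
      (∑ i : Fin n, ∑ j : Fin n, f (i.castAdd n) (j.natAdd n)) +
      ∑ i : Fin n, ∑ j ∈ Finset.Ioi i, f (i.natAdd n) (j.natAdd n) := by
  have key : ∀ {m : ℕ} (g : Fin m → Fin m → ℝ), ∑ i, ∑ j ∈ Finset.Ioi i, g i j =
      ∑ i, ∑ j, if i < j then g i j else 0 := fun g => by
    refine Finset.sum_congr rfl fun i _ => ?_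
    rw [← Finset.sum_filter]
    refine Finset.sum_congr ?_ fun _ _ => rfl
    ext j
    simp
  simp only [key, Fin.sum_univ_add]
  have h1 : ∀ i j : Fin n, i.castAdd n < j.natAdd n := fun i j => by
    rw [Fin.lt_def, Fin.val_castAdd, Fin.val_natAdd]
    omega
  have h2 : ∀ i j : Fin n, ¬ i.natAdd n < j.castAdd n := fun i j => by
    rw [Fin.lt_def, Fin.val_castAdd, Fin.val_natAdd]
    omega
  have h3 : ∀ i j : Fin n, (i.castAdd n < j.castAdd n) ↔ i < j := fun i j => Iff.rfl
  have h4 : ∀ i j : Fin n, (i.natAdd n < j.natAdd n) ↔ i < j := fun i j => by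
    rw [Fin.lt_def, Fin.lt_def, Fin.val_natAdd, Fin.val_natAdd, Nat.add_lt_add_iff_left]
  simp only [h1, h2, h3, h4, if_true, if_false, Finset.sum_const_zero, zero_add,
    Finset.sum_add_distrib]

theorem sum_sum_eq_sum_Ioi {n : ℕ} (f : Fin n → Fin n → ℝ) (hf : ∀ i j, i ≠ j → f i j = f j i) :
    ∑ i, ∑ j, f i j = 2 * (∑ i, ∑ j ∈ Finset.Ioi i, f i j) + ∑ i, f i i := by
  have h1 : ∀ i, ∑ j, f i j = ∑ j ∈ Finset.Ioi i, f i j + f i i + ∑ j ∈ Finset.Iio i, f i j := by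
    intro i
    have hu : (Finset.univ : Finset (Fin n)) = (insert i (Finset.Ioi i)) ∪ Finset.Iio i := by
      ext j
      simp only [Finset.mem_univ, Finset.mem_union, Finset.mem_insert, Finset.mem_Ioi,
        Finset.mem_Iio, true_iff]
      rcases lt_trichotomy j i with h | h | h
      exacts [Or.inr h, Or.inl (Or.inl h), Or.inl (Or.inr h)]
    rw [hu, Finset.sum_union, Finset.sum_insert (by simp), add_comm (f i i)]
    rw [Finset.disjoint_left]
    intro j hj hj'
    simp only [Finset.mem_insert, Finset.mem_Ioi, Finset.mem_Iio] at hj hj'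
    rcases hj with rfl | hj
    exacts [lt_irrefl _ hj', lt_asymm hj hj']
  have h2 : ∑ i, ∑ j ∈ Finset.Iio i, f i j = ∑ i, ∑ j ∈ Finset.Ioi i, f i j := by
    rw [Finset.sum_comm' (t' := Finset.univ) (s' := fun j => Finset.Ioi j)
      (by intro i j; simp)]
    exact Finset.sum_congr rfl fun i _ => Finset.sum_congr rfl fun j hj =>
      hf _ _ (Finset.mem_Ioi.1 hj).ne'
  rw [Finset.sum_congr rfl fun i _ => h1 i, Finset.sum_add_distrib, Finset.sum_add_distrib, h2]
  ring

variable {N : Type*} {τ : N → N} {G : N → N → ℝ} {R : N → ℝ} {R' : N → ℝ}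

/-- Vortex pairs and image pairs contribute equally, and so do the mixed pairs `(i, j)` and `(j,
i)`, so halving counts each once. The pairs of a vortex with its own image occur only once; the half
left of them turns `R` into `R'` in the self-energy. -/
theorem half_vortexHamiltonian_append (hττ : ∀ x, τ (τ x) = x) (hsymm : ∀ x y, G x y = G y x)
    (hG : ∀ x y, x ≠ y → G (τ x) (τ y) = G x y) (hR : ∀ x, R (τ x) = R x)
    (hR' : ∀ x, R' x = R x - G x (τ x)) {n : ℕ} (Γ : Fin n → ℝ) (x : Fin n → N)
    (hx : ∀ i j, i ≠ j → x i ≠ x j) (hx' : ∀ i j, i ≠ j → x i ≠ τ (x j)) :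
    1 / 2 * vortexHamiltonian G R (Fin.append Γ (-Γ)) (Fin.append x (τ ∘ x)) =
      vortexHamiltonian (twistedGreen τ G) R' Γ x := by
  unfold vortexHamiltonian
  rw [sum_Ioi_append, Fin.sum_univ_add]
  simp only [Fin.append_left, Fin.append_right, Pi.neg_apply, Function.comp_apply, hR, hR', twistedGreen,
    neg_sq]
  have h1 : ∑ i, ∑ j ∈ Finset.Ioi i, -Γ i * -Γ j * G (τ (x i)) (τ (x j)) =
      ∑ i, ∑ j ∈ Finset.Ioi i, Γ i * Γ j * G (x i) (x j) :=
    Finset.sum_congr rfl fun i _ => Finset.sum_congr rfl fun j hj => by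
      rw [hG _ _ (hx i j (Finset.mem_Ioi.1 hj).ne)]
      ring
  have h2 := sum_sum_eq_sum_Ioi (fun i j => Γ i * -Γ j * G (x i) (τ (x j))) fun i j hij => by
    have h3 : G (x i) (τ (x j)) = G (x j) (τ (x i)) := by
      rw [← hG _ _ (hx' i j hij), hττ, hsymm]
    simp only [h3]
    ring
  have h4 : ∑ i, ∑ j ∈ Finset.Ioi i, Γ i * Γ j * (G (x i) (x j) - G (x i) (τ (x j))) =
      (∑ i, ∑ j ∈ Finset.Ioi i, Γ i * Γ j * G (x i) (x j)) +
      ∑ i, ∑ j ∈ Finset.Ioi i, Γ i * -Γ j * G (x i) (τ (x j)) := by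
    simp only [← Finset.sum_add_distrib]
    exact Finset.sum_congr rfl fun i _ => Finset.sum_congr rfl fun j _ => by ring
  have h5 : ∑ i, Γ i ^ 2 * (R (x i) - G (x i) (τ (x i))) =
      ∑ i, Γ i ^ 2 * R (x i) + ∑ i, Γ i * -Γ i * G (x i) (τ (x i)) := by
    rw [← Finset.sum_add_distrib]
    exact Finset.sum_congr rfl fun i _ => by ring
  rw [h1, h2, h4, h5]
  ring

/-- A pair containing `k` changes sign twice, once through `Γ k` and once through the kernel; the
self-energies are even in `Γ` and invariant under `τ`. -/
theorem vortexHamiltonian_update {K : N → N → ℝ}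
    (hleft : ∀ x y, x ≠ y → x ≠ τ y → K (τ x) y = -K x y)
    (hright : ∀ x y, x ≠ y → x ≠ τ y → K x (τ y) = -K x y) (hR' : ∀ x, R' (τ x) = R' x) {n : ℕ}
    (Γ : Fin n → ℝ) (x : Fin n → N)
    (hx : ∀ i j, i ≠ j → x i ≠ x j) (hx' : ∀ i j, i ≠ j → x i ≠ τ (x j)) (k : Fin n) :
    vortexHamiltonian K R' (Function.update Γ k (-Γ k)) (Function.update x k (τ (x k))) =
      vortexHamiltonian K R' Γ x := by
  have h1 : ∑ i, ∑ j ∈ Finset.Ioi i, Function.update Γ k (-Γ k) i * Function.update Γ k (-Γ k) j *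
      K (Function.update x k (τ (x k)) i) (Function.update x k (τ (x k)) j) =
      ∑ i, ∑ j ∈ Finset.Ioi i, Γ i * Γ j * K (x i) (x j) := by
    refine Finset.sum_congr rfl fun i _ => Finset.sum_congr rfl fun j hj => ?_
    have hij : i ≠ j := (Finset.mem_Ioi.1 hj).ne
    by_cases hi : i = k
    · subst hi
      rw [Function.update_self, Function.update_self, Function.update_of_ne hij.symm,
        Function.update_of_ne hij.symm, hleft _ _ (hx _ _ hij) (hx' _ _ hij)]
      ring
    · by_cases hjk : j = k
      · subst hjk
        rw [Function.update_self, Function.update_self, Function.update_of_ne hij,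
          Function.update_of_ne hij, hright _ _ (hx _ _ hij) (hx' _ _ hij)]
        ring
      · rw [Function.update_of_ne hi, Function.update_of_ne hi, Function.update_of_ne hjk,
          Function.update_of_ne hjk]
  have h2 : ∑ i, Function.update Γ k (-Γ k) i ^ 2 * R' (Function.update x k (τ (x k)) i) =
      ∑ i, Γ i ^ 2 * R' (x i) := by
    refine Finset.sum_congr rfl fun i _ => ?_
    by_cases hi : i = k
    · subst hi
      rw [Function.update_self, Function.update_self, hR', neg_sq]
    · rw [Function.update_of_ne hi, Function.update_of_ne hi]
  rw [vortexHamiltonian, vortexHamiltonian, h1, h2]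

end Hamiltonian

/-! ### The twisted Green's function -/

section Twisted

variable {N : Type*} [EMetricSpace N] [MeasurableSpace N] [BorelSpace N]
  [ChartedSpace Plane N] [IsManifold (𝓡 2) ∞ N]
  [RiemannianBundle (fun x : N => TangentSpace (𝓡 2) x)]
  [IsContMDiffRiemannianBundle (𝓡 2) ∞ Plane (fun x : N => TangentSpace (𝓡 2) x)]

/-- The background terms of the poles `y` and `τ y` are equal and cancel in the difference, leaving
two opposite delta functions. -/
theorem IsGreenFunction.isTwistedGreenFunction {τ : N → N} {G : N → N → ℝ}
    (hG : IsGreenFunction G) (hττ : ∀ x, τ (τ x) = x)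
    (hGτ : ∀ x y, x ≠ y → G (τ x) (τ y) = G x y) :
    IsTwistedGreenFunction τ (twistedGreen τ G) where
  symm x y _ hxy' := by
    rw [twistedGreen, twistedGreen, hG.symm x y, ← hGτ x (τ y) hxy', hττ, hG.symm (τ x)]
  twisted_left x y hxy hxy' := by
    have h1 : G (τ x) y = G x (τ y) := by rw [← hGτ x (τ y) hxy', hττ]
    rw [twistedGreen, twistedGreen, hGτ x y hxy, h1, neg_sub]
  twisted_right x y _ _ := by
    rw [twistedGreen, twistedGreen, hττ, neg_sub]
  smooth y := ((hG.smooth y).mono (compl_subset_compl.2 (by simp))).sub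
    ((hG.smooth (τ y)).mono (compl_subset_compl.2 (by simp)))
  laplacian y := by
    have hs : ({y, τ y} : Set N).Finite := by simp
    have h1 := (hG.smooth y).mono (compl_subset_compl.2 (by simp : {y} ⊆ ({y, τ y} : Set N)))
    have h2 := (hG.smooth (τ y)).mono (compl_subset_compl.2 (by simp : {τ y} ⊆ ({y, τ y} : Set N)))
    have i1 := (hG.laplacian y).locallyIntegrable_gradient
    have i2 := (hG.laplacian (τ y)).locallyIntegrable_gradient
    refine ⟨(hG.laplacian y).locallyIntegrable.sub (hG.laplacian (τ y)).locallyIntegrable,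
      locallyIntegrable_norm_surfaceGradient_sub hs h1 h2 i1 i2, fun φ hφ hφc => ?_⟩
    have e1 := (hG.laplacian y).eq φ hφ hφc
    have e2 := (hG.laplacian (τ y)).eq φ hφ hφc
    have e3 := integral_inner_surfaceGradient_sub hs h1 h2 i1 i2 hφ hφc.isCompact
      fun x hx => mfderiv_eq_zero_of_notMem_tsupport hx
    simp only [twistedGreen]
    rw [e3]
    linarith

omit [IsManifold (𝓡 2) ∞ N]
  [IsContMDiffRiemannianBundle (𝓡 2) ∞ Plane (fun x : N => TangentSpace (𝓡 2) x)] in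
-- Since `τ x ≠ x`, the term `G x (τ y)` is continuous at `y = x`, and only `G x y` is singular. The
-- limit sees `d` only near `x`, so agreement with the geodesic distance there suffices.
theorem IsGreenFunction.isRobinFunction_twistedGreen {τ : N → N} {G : N → N → ℝ}
    (hG : IsGreenFunction G) (hτ : Continuous τ) (hτne : ∀ x, τ x ≠ x) {R R' : N → ℝ}
    (hR : IsRobinFunction geodesicDist G R) (hR' : ∀ x, R' x = R x - G x (τ x))
    {d : N → N → ℝ} (hd : ∀ x, ∀ᶠ y in 𝓝 x, d x y = geodesicDist x y) :
    IsRobinFunction d (twistedGreen τ G) R' := by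
  intro x
  have h1 : ContinuousAt (fun z => G z x) (τ x) :=
    (hG.smooth x).continuousOn.continuousAt (isOpen_compl_singleton.mem_nhds (hτne x))
  have h2 : Tendsto (fun y => G (τ y) x) (𝓝[≠] x) (𝓝 (G (τ x) x)) :=
    (h1.tendsto.comp hτ.continuousAt.tendsto).mono_left nhdsWithin_le_nhds
  rw [hR', hG.symm x (τ x)]
  refine ((hR x).sub h2).congr' ?_
  filter_upwards [nhdsWithin_le_nhds (hd x)] with y hy
  rw [twistedGreen, hy, hG.symm x (τ y)]
  ring

end Twisted

/-! ### Assembly of the theorem -/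

theorem mainTheorem6 {M N : Type*}
    -- the surface `M`: connected, Riemannian, non-orientable
    [EMetricSpace M] [ChartedSpace Plane M] [IsManifold (𝓡 2) ∞ M]
    [RiemannianBundle (fun x : M => TangentSpace (𝓡 2) x)]
    [IsContMDiffRiemannianBundle (𝓡 2) ∞ Plane (fun x : M => TangentSpace (𝓡 2) x)]
    [IsRiemannianManifold (𝓡 2) M] [ConnectedSpace M]
    (hM : ¬ IsOrientableSurface M)
    -- its orientation double cover `N`
    [EMetricSpace N] [ChartedSpace Plane N] [IsManifold (𝓡 2) ∞ N]
    [RiemannianBundle (fun x : N => TangentSpace (𝓡 2) x)]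
    [IsContMDiffRiemannianBundle (𝓡 2) ∞ Plane (fun x : N => TangentSpace (𝓡 2) x)]
    [IsRiemannianManifold (𝓡 2) N] [MeasurableSpace N] [BorelSpace N]
    (p : N → M) (τ : N → N) (o : OrientationField N) (hcover : IsOrientationDoubleCover p τ o)
    -- the Green's function and the Robin function of `N`
    (G : N → N → ℝ) (hG : IsGreenFunction G)
    (hends : NoncompactSpace N → HasSymmetricEnds τ G)
    (R : N → ℝ) (hR : IsRobinFunction geodesicDist G R) :
    IsTwistedGreenFunction τ (twistedGreen τ G) ∧
    ∃ RM : M → ℝ,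
      (∀ x : N, RM (p x) = R x - G x (τ x)) ∧
      IsRobinFunction geodesicDist (twistedGreen τ G) (RM ∘ p) ∧
      IsRobinFunction (fun x y => geodesicDist (p x) (p y)) (twistedGreen τ G) (RM ∘ p) ∧
      ∀ (n : ℕ) (Γ : Fin n → ℝ) (x : Fin n → N), (∀ i j, i ≠ j → p (x i) ≠ p (x j)) →
        1 / 2 * vortexHamiltonian G R (Fin.append Γ (-Γ)) (Fin.append x (τ ∘ x)) =
            vortexHamiltonian (twistedGreen τ G) (RM ∘ p) Γ x ∧
        ∀ k : Fin n,
          vortexHamiltonian (twistedGreen τ G) (RM ∘ p)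
              (Function.update Γ k (-Γ k)) (Function.update x k (τ (x k))) =
            vortexHamiltonian (twistedGreen τ G) (RM ∘ p) Γ x := by
  have hconn : ConnectedSpace N := hcover.connectedSpace hM
  have hττ := hcover.swap_swap
  have hGτ : ∀ x y, x ≠ y → G (τ x) (τ y) = G x y := fun x y hxy =>
    hcover.green_swap hG hends hR hxy
  have hRτ : ∀ x, R (τ x) = R x := hcover.robin_swap hG hends hR
  have htw := hG.isTwistedGreenFunction hττ hGτ
  have hinv : ∀ x, R (τ x) - G (τ x) (τ (τ x)) = R x - G x (τ x) := fun x => by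
    rw [hττ, hRτ, hG.symm]
  -- An arbitrary choice of lifts, with no continuity; by `hinv` the value of `RM` does not depend
  -- on it.
  choose s hs using hcover.surjective
  have hRM : ∀ x, R (s (p x)) - G (s (p x)) (τ (s (p x))) = R x - G x (τ x) := fun x => by
    rcases (hcover.fibre x (s (p x))).1 (hs (p x)) with h | h
    · rw [h]
    · rw [h, hinv]
  refine ⟨htw, fun m => R (s m) - G (s m) (τ (s m)), hRM, ?_, ?_, fun n Γ x hx => ?_⟩
  · exact hG.isRobinFunction_twistedGreen hcover.continuous_swap hcover.swap_ne hR hRM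
      fun x => Eventually.of_forall fun y => rfl
  · refine hG.isRobinFunction_twistedGreen hcover.continuous_swap hcover.swap_ne hR hRM fun x => ?_
    filter_upwards [hcover.eventually_edist_map_eq x] with y hy
    simp only [geodesicDist, hy]
  · have hx1 : ∀ i j, i ≠ j → x i ≠ x j := fun i j hij h => hx i j hij (by rw [h])
    have hx2 : ∀ i j, i ≠ j → x i ≠ τ (x j) := fun i j hij h =>
      hx i j hij (by rw [h, hcover.map_swap])
    refine ⟨half_vortexHamiltonian_append hττ hG.symm hGτ hRτ hRM Γ x hx1 hx2, fun k => ?_⟩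
    refine vortexHamiltonian_update htw.twisted_left htw.twisted_right (fun z => ?_) Γ x hx1 hx2 k
    simp only [Function.comp_apply, hcover.map_swap]
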